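/- Let $\mathbb F_q$ be a finite field with $q$ elements, whose elements are identified with the digits $0,\dots,q-1$ by an arbitrary bijection, and let $0\le k\le n$. For a $k$-dimensional subspace $X$ of $\mathbb F_q^n$ let $\mathrm{RE}(X)$ be its $k\times n$ basis matrix in reduced row echelon form. Number the columns of $\mathrm{RE}(X)$ without a leading coefficient from right to left by $1,\dots,n-k$; the Ferrers diagram $\mathcal F_X=(\mathcal F_{n-k},\dots,\mathcal F_1)$ has in column $i$ as many dots $\mathcal F_i$ as there are rows whose leading coefficient is to the left of the $i$-th of these columns. The Ferrers tableaux form $\mathcal F(X)$ fills these dots with the corresponding entries of $\mathrm{RE}(X)$; its entries vector $x=(x_1,x_2,\dots)$ lists them column by column from right to left, each column from top to bottom, and $\{x\}$ is its value as a base-$q$ number with most significant digit $x_1$. Write $|\mathcal F_X|=\sum_i\mathcal F_i$. Order the subspaces by: $X<Y$ if $|\mathcal F_X|>|\mathcal F_Y|$; or $|\mathcal F_X|=|\mathcal F_Y|$ and the diagram of $X$ has more dots than that of $Y$ in the least column $i$ in which they differ; or $\mathcal F_X=\mathcal F_Y$ and $\{x\}<\{y\}$. Let $\mathrm{Ind}_{\mathcal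 F}(X)$ be the number of subspaces preceding $X$. For nonnegative integers $a,b,m$ let $p(a,b,m)$ be the number of partitions of $m$ whose Ferrers diagram fits into an $a\times b$ box; put $\alpha_m=p(k,n-k,m)$. Encoding Algorithm C, on input an index $0\le i<\binom{n}{k}_q=\prod_{j=0}^{k-1}\frac{q^{n-j}-1}{q^{k-j}-1}$ given by its base-$q$ digits, works as follows. It first tabulates $p(a,b,m)$ for $a\le k$, $b\le n-k$, $m\le k(n-k)$ by the recurrence $p(a,b,m)=p(a,b-1,m-a)+p(a-1,b,m)$ for $a,b,m\ge1$ (the first term being $0$ if $m<a$), with $p(a,b,0)=1$ and $p(a,b,m)=0$ if $ab=0<m$. It sets $i_0=i$ and for $j=0,1,\dots,k(n-k)$, with $m=k(n-k)-j$: if $i_j\ge\alpha_mq^m$ it sets $i_{j+1}=i_j-\alpha_mq^m$ and continues; otherwise it writes $i_j=hq^m+r$ with $0\le r<q^m$, determines the diagram $\mathcal F=(\mathcal F_{n-k},\dots,\mathcal F_1)$ of size $m$ with index $h$ as described next, lets $x$ be the base-$q$ representation of $r$ with $m$ digits, outputs $(\mathcal F,x)$ and stops. The diagram is found column by column: put $\mathcal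 F_0=k$; for $j=1,\dots,n-k$, if $j\ge2$ and $\mathcal F_1+\dots+\mathcal F_{j-1}=m$ set $\mathcal F_j=0$; otherwise start with $a=\mathcal F_{j-1}$ and, while $h\ge N(a):=p(a,n-k-j,m-\mathcal F_1-\dots-\mathcal F_{j-1}-a)$ (read from the table, and $0$ if the last argument is negative), replace $h$ by $h-N(a)$ and $a$ by $a-1$; then set $\mathcal F_j=a$. Cost is counted in digit operations: adding, subtracting, comparing, reading or writing one $q$-ary digit costs one operation; multiplication by, and division with remainder by, a power of $q$ are shifts charged by the number of digits moved; operations on loop counters and table addresses are charged by the numbers of $q$-ary digits of the operands (the single multiplication $k\cdot(n-k)$ as schoolbook multiplication). Theorem. For all $0\le k\le n$ and every $0\le i<\binom{n}{k}_q$, the output of Encoding Algorithm C on input $i$ is the Ferrers tableaux form of exactly one $k$-dimensional subspace $X$ of $\mathbb F_q^n$, and $\mathrm{Ind}_{\mathcal F}(X)=i$. Moreover there is an absolute constant $C$ such that, for all $q$, all $0<k<n$ and all such $i$, the algorithm uses at most $C\,k^{5/2}(n-k)^{5/2}$ digit operations. -/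

import Mathlib

/-! ## The Grassmannian, reduced row echelon forms and Ferrers tableaux forms -/

/-- The Grassmannian: all `k`-dimensional subspaces of `F ^ n`. -/
abbrev Grass (F : Type*) [Field F] (n k : ℕ) : Type _ :=
  {X : Submodule F (Fin n → F) // Module.finrank F X = k}

/-- The `q`-ary Gaussian coefficient `∏_{i < k} (q ^ (n - i) - 1) / (q ^ (k - i) - 1)`.
For `k > n` the factor `i = n` makes the product `0`. -/
def gaussCoeff (q n k : ℕ) : ℚ :=
  ∏ i ∈ Finset.range k, ((q : ℚ) ^ (n - i) - 1) / ((q : ℚ) ^ (k - i) - 1)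

/-- `M` is a `k × n` matrix in reduced row echelon form without zero rows, the leading
coefficient of row `r` being in column `piv r`. -/
structure IsRREF {F : Type*} [Field F] {n k : ℕ} (M : Matrix (Fin k) (Fin n) F)
    (piv : Fin k → Fin n) : Prop where
  pivot_strictMono : StrictMono piv
  zero_left : ∀ r c, c < piv r → M r c = 0
  pivot_one : ∀ r, M r (piv r) = 1
  pivot_column : ∀ r s, s ≠ r → M s (piv r) = 0

/-- The columns without a leading coefficient, listed from right to left. -/
def freeColumns {n k : ℕ} (piv : Fin k → Fin n) : List (Fin n) :=
  (List.finRange n).reverse.filter fun c => decide (∀ r, piv r ≠ c)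

/-- The rows whose leading coefficient is to the left of column `c`, from top to bottom. -/
def rowsBefore {n k : ℕ} (piv : Fin k → Fin n) (c : Fin n) : List (Fin k) :=
  (List.finRange k).filter fun r => decide (piv r < c)

/-- The Ferrers diagram of a matrix in reduced row echelon form, as the list
`[𝓕₁, 𝓕₂, …, 𝓕_{n-k}]` of its column heights, the columns being numbered from right to left.
Row `r` of the diagram has one dot for each column without a leading coefficient that is to the
right of `piv r`; these dots are shifted to the right. -/
def diagramOf {n k : ℕ} (piv : Fin k → Fin n) : List ℕ :=
  (freeColumns piv).map fun c => (rowsBefore piv c).length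

/-- The entries vector `(x₁, x₂, …)` of the Ferrers tableaux form, the entries being numbered
column by column from right to left and in each column from top to bottom. The bijection `e`
turns field elements into digits `0, …, q - 1`. -/
def entriesOf {F : Type*} {q n k : ℕ} (e : F ≃ Fin q) (M : Matrix (Fin k) (Fin n) F)
    (piv : Fin k → Fin n) : List ℕ :=
  (freeColumns piv).flatMap fun c => (rowsBefore piv c).map fun r => (e (M r c) : ℕ)

/-- The Ferrers tableaux form of the subspace `X` has diagram `D` (column heights, from right to
left) and entries vector `x`. Each `X` has exactly one such pair `(D, x)`. -/
def HasTableauxForm {F : Type*} [Field F] {q n k : ℕ} (e : F ≃ Fin q) (X : Grass F n k)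
    (D x : List ℕ) : Prop :=
  ∃ (M : Matrix (Fin k) (Fin n) F) (piv : Fin k → Fin n), IsRREF M piv ∧
    Submodule.span F (Set.range M.row) = X.1 ∧ D = diagramOf piv ∧ x = entriesOf e M piv

/-- The value `{x}` of a vector of digits read as a number in base `q`, the first digit being the
most significant one. -/
def vecValue (q : ℕ) (x : List ℕ) : ℕ := Nat.ofDigits q x.reverse

/-- The order of Ferrers tableaux forms: larger diagrams first; among diagrams of the same size,
the one with more dots in the first column where they differ comes first; for equal diagrams,
by the value of the entries vector. -/
def TableauxLT (q : ℕ) (D x D' x' : List ℕ) : Prop :=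
  D'.sum < D.sum ∨
  (D.sum = D'.sum ∧ List.Lex (fun a b : ℕ => b < a) D D') ∨
  (D = D' ∧ vecValue q x < vecValue q x')

/-- The order of the Grassmannian induced by Ferrers tableaux forms. -/
def GrassLT {F : Type*} [Field F] {q n k : ℕ} (e : F ≃ Fin q) (X Y : Grass F n k) : Prop :=
  ∃ D x D' x', HasTableauxForm e X D x ∧ HasTableauxForm e Y D' x' ∧ TableauxLT q D x D' x'

/-- The lexicographic index of `X`: the number of subspaces that precede `X`. -/
noncomputable def indF {F : Type*} [Field F] {q n k : ℕ} (e : F ≃ Fin q) (X : Grass F n k) : ℕ :=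
  Nat.card {Y : Grass F n k // GrassLT e Y X}

/-! ## Counting digit operations

A program is an element of `Counted α`: its result together with the number of digit operations
spent. Programs are composed from the primitives below; each of them charges for every `q`-ary
digit that it adds, subtracts, multiplies, compares, reads or writes. Large integers are lists of
digits with the least significant digit first. Loop counters and table addresses are natural
numbers, and operations on them are charged by the lengths of their `q`-ary representations. -/

structure Counted (α : Type) where
  val : α
  cost : ℕ

namespace Counted

instance : Monad Counted where
  pure a := ⟨a, 0⟩
  bind x f := ⟨(f x.val).val, x.cost + (f x.val).cost⟩

/-! ### Operations on single digits -/

/-- Full adder: the sum digit and the carry. -/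
def digitAdd (q a b c : ℕ) : Counted (ℕ × ℕ) :=
  ⟨((a + b + c) % q, (a + b + c) / q), 1⟩

/-- Full subtractor: the difference digit and the borrow. -/
def digitSub (q a b c : ℕ) : Counted (ℕ × ℕ) :=
  ⟨if b + c ≤ a then (a - (b + c), 0) else (a + q - (b + c), 1), 1⟩

def digitCmp (a b : ℕ) : Counted Ordering := ⟨compare a b, 1⟩

def digitWrite (a : ℕ) : Counted ℕ := ⟨a, 1⟩

/-! ### Operations on indices -/

/-- The number of `q`-ary digits of an index. -/
def idxLen (q a : ℕ) : ℕ := (Nat.digits q a).length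

def idxAdd (q a b : ℕ) : Counted ℕ := ⟨a + b, idxLen q a + idxLen q b + 1⟩

/-- Subtraction of indices, used only for `b ≤ a`. -/
def idxSub (q a b : ℕ) : Counted ℕ := ⟨a - b, idxLen q a + idxLen q b + 1⟩

/-- Schoolbook multiplication of indices. -/
def idxMul (q a b : ℕ) : Counted ℕ := ⟨a * b, 2 * (idxLen q a + 1) * (idxLen q b + 1)⟩

def idxLt (q a b : ℕ) : Counted Bool := ⟨decide (a < b), idxLen q a + idxLen q b + 1⟩

def idxEq (q a b : ℕ) : Counted Bool := ⟨decide (a = b), idxLen q a + idxLen q b + 1⟩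

def idxWrite (q a : ℕ) : Counted ℕ := ⟨a, idxLen q a + 1⟩

/-! ### Operations on large integers -/

/-- Addition with an incoming carry. -/
def qAddCarry (q : ℕ) : List ℕ → List ℕ → ℕ → Counted (List ℕ)
  | [], [], c => do
    match ← digitCmp c 0 with
    | .eq => pure []
    | _ => do
      let d ← digitWrite c
      pure [d]
  | a :: as, [], c => do
    let s ← digitAdd q a 0 c
    let r ← qAddCarry q as [] s.2
    pure (s.1 :: r)
  | [], b :: bs, c => do
    let s ← digitAdd q 0 b c
    let r ← qAddCarry q [] bs s.2
    pure (s.1 :: r)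
  | a :: as, b :: bs, c => do
    let s ← digitAdd q a b c
    let r ← qAddCarry q as bs s.2
    pure (s.1 :: r)

def qAdd (q : ℕ) (x y : List ℕ) : Counted (List ℕ) := qAddCarry q x y 0

/-- Subtraction with an incoming borrow, used only where the result is nonnegative and the
subtrahend is not longer than the minuend. -/
def qSubBorrow (q : ℕ) : List ℕ → List ℕ → ℕ → Counted (List ℕ)
  | [], _, _ => pure []
  | a :: as, [], c => do
    let s ← digitSub q a 0 c
    let r ← qSubBorrow q as [] s.2
    pure (s.1 :: r)
  | a :: as, b :: bs, c => do
    let s ← digitSub q a b c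
    let r ← qSubBorrow q as bs s.2
    pure (s.1 :: r)

def qSub (q : ℕ) (x y : List ℕ) : Counted (List ℕ) := qSubBorrow q x y 0

/-- The verdict on `x < y` after one more significant digit has been compared. -/
def updateVerdict (r : Bool) : Ordering → Bool
  | .lt => true
  | .eq => r
  | .gt => false

/-- Comparison, where `r` is the verdict of the less significant digits. -/
def qLessAux : List ℕ → List ℕ → Bool → Counted Bool
  | [], [], r => pure r
  | a :: as, [], r => do
    let o ← digitCmp a 0
    qLessAux as [] (updateVerdict r o)
  | [], b :: bs, r => do
    let o ← digitCmp 0 b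
    qLessAux [] bs (updateVerdict r o)
  | a :: as, b :: bs, r => do
    let o ← digitCmp a b
    qLessAux as bs (updateVerdict r o)

/-- The test `x < y`. -/
def qLess (x y : List ℕ) : Counted Bool := qLessAux x y false

/-- Multiplication by `q ^ m`: a shift by `m` digits. -/
def qShift (m : ℕ) (x : List ℕ) : Counted (List ℕ) :=
  ⟨List.replicate m 0 ++ x, m + x.length⟩

/-- The quotient of the integer division by `q ^ m`. -/
def qDivPow (m : ℕ) (x : List ℕ) : Counted (List ℕ) := ⟨x.drop m, x.length⟩

/-- The remainder of the integer division by `q ^ m`, with exactly `m` digits. -/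
def qModPow (m : ℕ) (x : List ℕ) : Counted (List ℕ) :=
  ⟨x.take m ++ List.replicate (m - x.length) 0, m⟩

/-- The same digits with the most significant one first. -/
def qReverse (x : List ℕ) : Counted (List ℕ) := ⟨x.reverse, x.length⟩

/-! ### Loops and the table of partition numbers -/

/-- `for j = start, …, start + count - 1 do body`, the counter `j` being incremented and tested
after each round. -/
def forLoop {σ : Type} (q : ℕ) (body : ℕ → σ → Counted σ) :
    (count start : ℕ) → σ → Counted σ
  | 0, _, s => pure s
  | c + 1, j, s => do
    let s₁ ← body j s
    let j₁ ← idxAdd q j 1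
    let _ ← idxEq q j₁ (j + c + 1)
    forLoop q body c j₁ s₁

/-- A memory whose cell `(j, l, i)` is meant to hold `p(j, l, i)`, the number of partitions of `i`
whose Ferrers diagrams fit into a `j × l` box. -/
abbrev Table := ℕ × ℕ × ℕ → List ℕ

/-- The cost of addressing a cell. -/
def addrCost (q : ℕ) (a : ℕ × ℕ × ℕ) : ℕ :=
  idxLen q a.1 + idxLen q a.2.1 + idxLen q a.2.2 + 1

def readCell (q : ℕ) (T : Table) (a : ℕ × ℕ × ℕ) : Counted (List ℕ) :=
  ⟨T a, addrCost q a + (T a).length⟩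

def writeCell (q : ℕ) (T : Table) (a : ℕ × ℕ × ℕ) (x : List ℕ) : Counted Table :=
  ⟨Function.update T a x, addrCost q a + x.length⟩

/-- Compute `p(j, l, i)` from earlier cells by
`p(j, l, i) = p(j, l - 1, i - j) + p(j - 1, l, i)`, the first term being `0` for `i < j`, with
`p(j, l, 0) = 1` and `p(j, l, i) = 0` for `i > 0`, `j l = 0`. -/
def fillCell (q j l i : ℕ) (T : Table) : Counted Table := do
  if ← idxEq q i 0 then
    writeCell q T (j, l, i) [1]
  else if ← idxEq q j 0 then
    writeCell q T (j, l, i) []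
  else if ← idxEq q l 0 then
    writeCell q T (j, l, i) []
  else do
    let j₁ ← idxSub q j 1
    let y ← readCell q T (j₁, l, i)
    if ← idxLt q i j then
      writeCell q T (j, l, i) y
    else do
      let l₁ ← idxSub q l 1
      let i₁ ← idxSub q i j
      let x ← readCell q T (j, l₁, i₁)
      let s ← qAdd q x y
      writeCell q T (j, l, i) s

/-- The table of `p(j, l, i)` for `j ≤ k`, `l ≤ η` and `i ≤ N`. -/
def buildTable (q k η N : ℕ) : Counted Table :=
  forLoop q (fun j => forLoop q (fun l => forLoop q (fun i => fillCell q j l i)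
    (N + 1) 0) (η + 1) 0) (k + 1) 0 (fun _ => [])

/-! ### Encoding Algorithm B: from an index to a Ferrers diagram of size `m` -/

/-- `N_m(a, 𝓕_{j-1}, …, 𝓕₁) = p(a, η - j, m - S - a)`, where `S = 𝓕₁ + ⋯ + 𝓕_{j-1}`. -/
def lookupN (q η : ℕ) (T : Table) (m j S a : ℕ) : Counted (List ℕ) := do
  let S₁ ← idxAdd q S a
  if ← idxLt q m S₁ then
    pure []
  else do
    let i ← idxSub q m S₁
    let l ← idxSub q η j
    readCell q T (a, l, i)

/-- `while h ≥ N_m(a, 𝓕_{j-1}, …, 𝓕₁)` decrease `h` by this number and `a` by `1`. The result is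
the final `(a, h)`. (For a valid index the test fails at `a = 0` at the latest.) -/
def whileB (q η : ℕ) (T : Table) (m j S : ℕ) : ℕ → List ℕ → Counted (ℕ × List ℕ)
  | 0, h => do
    let v ← lookupN q η T m j S 0
    let _ ← qLess h v
    pure (0, h)
  | a + 1, h => do
    let v ← lookupN q η T m j S (a + 1)
    if ← qLess h v then
      pure (a + 1, h)
    else do
      let h₁ ← qSub q h v
      let _ ← idxSub q (a + 1) 1
      whileB q η T m j S a h₁

/-- Step 2: the columns `𝓕_j, 𝓕_{j+1}, …` (`count` of them), where `a = 𝓕_{j-1}` and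
`S = 𝓕₁ + ⋯ + 𝓕_{j-1}`. -/
def columnsB (q η : ℕ) (T : Table) (m : ℕ) :
    (count j a S : ℕ) → List ℕ → Counted (List ℕ)
  | 0, _, _, _, _ => pure []
  | c + 1, j, a, S, h => do
    let j₁ ← idxAdd q j 1
    let _ ← idxLt q η j₁
    if ← idxEq q S m then
      let b ← idxWrite q 0
      let r ← columnsB q η T m c j₁ b S h
      pure (b :: r)
    else do
      let w ← whileB q η T m j S a h
      let b ← idxWrite q w.1
      let S₁ ← idxAdd q S b
      let r ← columnsB q η T m c j₁ b S₁ w.2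
      pure (b :: r)

/-- Encoding Algorithm B; the output is `[𝓕₁, …, 𝓕_η]`. -/
def algorithmB (q k η : ℕ) (T : Table) (m : ℕ) (h : List ℕ) : Counted (List ℕ) :=
  match η with
  | 0 => pure []
  | c + 1 => do
    let w ← whileB q (c + 1) T m 1 0 k h
    let b ← idxWrite q w.1
    let r ← columnsB q (c + 1) T m c 2 b b w.2
    pure (b :: r)

/-! ### Encoding Algorithm C: from an index to a Ferrers tableaux form -/

/-- The rounds `j, j + 1, …` (`count` of them) of the main loop, where `y` is `i_j` and
`N = k η`. -/
def searchC (q k η N : ℕ) (T : Table) :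
    (count j : ℕ) → List ℕ → Counted (Option (List ℕ × List ℕ))
  | 0, _, _ => pure none
  | c + 1, j, y => do
    let m ← idxSub q N j
    let α ← readCell q T (k, η, m)
    let A ← qShift m α
    if ← qLess y A then
      let h ← qDivPow m y
      let D ← algorithmB q k η T m h
      let r ← qModPow m y
      let x ← qReverse r
      pure (some (D, x))
    else do
      let y₁ ← qSub q y A
      let j₁ ← idxAdd q j 1
      let _ ← idxLt q N j₁
      searchC q k η N T c j₁ y₁

/-- Encoding Algorithm C. The input is an index `i` by its `q`-ary digits; the output is the
Ferrers diagram (column heights, from right to left) and the entries vector. -/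
def algorithmC (q n k : ℕ) (i : List ℕ) : Counted (Option (List ℕ × List ℕ)) := do
  let η ← idxSub q n k
  let N ← idxMul q k η
  let T ← buildTable q k η N
  searchC q k η N T (N + 1) 0 i

end Counted

/-! The order on tableaux forms is realised by an explicit rank. If `(D, x)` has `m` dots,
`formRank` adds the number of forms with more than `m` dots, `q ^ m` times the number `diagRank` of
diagrams of size `m` preceding `D`, and the value of `x`. The rank is strictly monotone
(`IsForm.formRank_lt`) and the order is total on forms, so the rank is injective and reflects the
order.

Algorithm C inverts this rank: the main loop strips off the blocks `α_m q^m`, division by `q^m`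
separates the diagram index from the entries, and the column search undoes `diagRank`. Hence every
`i` below `∑ α_m q^m` is the rank of the form that is output (`algorithmC_result`). This sum is the
Gaussian coefficient, because the box polynomial satisfies a `q`-Pascal rule
(`eval_boxPoly_mul_prod`). Uniqueness of reduced row echelon forms makes forms and subspaces
correspond bijectively. Since all smaller ranks are attained as well, the rank of `X` equals the
number of its predecessors (`indF_eq_formRank`).

For the cost put `η = n - k` and `N = k η`. The table has `O(N ^ 2)` cells, and each costs a bounded
multiple of the lengths of addresses and partition numbers. Both lengths are `O(√N)`, uniformly in
`q`, because a partition number of `m` is at most `exp (O(√m))` (`boxCount_le_two_pow`). This gives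
`N ^ (5/2)`. The search needs only `O(N)` rounds on numbers of `O(N)` digits, hence `O(N ^ 2)`
operations. -/

namespace Counted

/-! ### Correctness and cost of the digit arithmetic -/

@[simp] theorem val_bind {α β : Type} (x : Counted α) (f : α → Counted β) :
    (x >>= f).val = (f x.val).val := rfl

@[simp] theorem cost_bind {α β : Type} (x : Counted α) (f : α → Counted β) :
    (x >>= f).cost = x.cost + (f x.val).cost := rfl

@[simp] theorem val_pure {α : Type} (a : α) : (pure a : Counted α).val = a := rfl

@[simp] theorem cost_pure {α : Type} (a : α) : (pure a : Counted α).cost = 0 := rfl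

/-- All members of `x` are digits in base `q`. -/
def IsDigits (q : ℕ) (x : List ℕ) : Prop := ∀ d ∈ x, d < q

theorem isDigits_digits {q : ℕ} (hq : 2 ≤ q) (a : ℕ) : IsDigits q (Nat.digits q a) :=
  fun _ hd => Nat.digits_lt_base (by omega) hd

theorem isDigits_cons {q a : ℕ} {x : List ℕ} : IsDigits q (a :: x) ↔ a < q ∧ IsDigits q x := by
  simp [IsDigits]

/-- Removing the last digits leaves `a / q`, `b / q` and a carry of at most `1`, and `a + b` drops
unless both vanish. The result has no leading zeros, so table cells stay canonical and their lengths
are those of partition numbers. -/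
theorem qAddCarry_digits_val {q : ℕ} (hq : 2 ≤ q) (a b c : ℕ) (hc : c ≤ 1) :
    (qAddCarry q (Nat.digits q a) (Nat.digits q b) c).val = Nat.digits q (a + b + c) := by
  induction h : a + b using Nat.strong_induction_on generalizing a b c with
  | _ s ih =>
  have q0 : 0 < q := by omega
  have step : ∀ u v : ℕ, (u + v + c) % q = (u % q + v % q + c) % q ∧
      (u + v + c) / q = u / q + v / q + (u % q + v % q + c) / q := by
    intro u v
    have hu := Nat.div_add_mod u q
    have hv := Nat.div_add_mod v q
    have : u + v + c = (u % q + v % q + c) + q * (u / q + v / q) := by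
      rw [mul_add]; omega
    rw [this, Nat.add_mul_mod_self_left, Nat.add_mul_div_left _ _ q0]
    exact ⟨rfl, by ring⟩
  have carry : ∀ u v : ℕ, (u % q + v % q + c) / q ≤ 1 := by
    intro u v
    have hu := Nat.mod_lt u q0
    have hv := Nat.mod_lt v q0
    have : (u % q + v % q + c) / q < 2 := by
      rw [Nat.div_lt_iff_lt_mul q0]; omega
    omega
  have red : ∀ u v : ℕ, 0 < u + v → u / q + v / q < u + v := by
    intro u v huv
    have hu := Nat.div_le_self u q
    have hv := Nat.div_le_self v q
    rcases Nat.eq_zero_or_pos u with hu0 | hu0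
    · have := Nat.div_lt_self (show 0 < v by omega) hq
      omega
    · have := Nat.div_lt_self hu0 hq
      omega
  rw [← h]
  rcases Nat.eq_zero_or_pos a with rfl | ha <;> rcases Nat.eq_zero_or_pos b with rfl | hb
  · have : c = 0 ∨ c = 1 := by omega
    rcases this with rfl | rfl
    · simp [qAddCarry, digitCmp, compare, compareOfLessAndEq]
    · simp [qAddCarry, digitCmp, digitWrite, compare, compareOfLessAndEq,
        Nat.digits_of_lt q 1 (by omega) (by omega)]
  · rw [Nat.digits_def' hq hb, Nat.digits_def' hq (show 0 < 0 + b + c by omega)]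
    simp only [Nat.digits_zero, qAddCarry, val_bind, val_pure, digitAdd]
    have h1 := step 0 b
    have h2 := carry 0 b
    have h3 := red 0 b (by omega)
    simp only [Nat.zero_mod, Nat.zero_div] at h1 h2 h3
    have := ih _ (by omega) 0 (b / q) _ h2 rfl
    rw [Nat.digits_zero] at this
    rw [this, h1.1, h1.2]
  · rw [Nat.digits_def' hq ha, Nat.digits_def' hq (show 0 < a + 0 + c by omega)]
    simp only [Nat.digits_zero, qAddCarry, val_bind, val_pure, digitAdd]
    have h1 := step a 0
    have h2 := carry a 0
    have h3 := red a 0 (by omega)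
    simp only [Nat.zero_mod, Nat.zero_div] at h1 h2 h3
    have := ih _ (by omega) (a / q) 0 _ h2 rfl
    rw [Nat.digits_zero] at this
    rw [this, h1.1, h1.2]
  · rw [Nat.digits_def' hq ha, Nat.digits_def' hq hb,
      Nat.digits_def' hq (show 0 < a + b + c by omega)]
    simp only [qAddCarry, val_bind, val_pure, digitAdd]
    have h1 := step a b
    have h2 := carry a b
    have h3 := red a b (by omega)
    rw [ih _ (by omega) (a / q) (b / q) _ h2 rfl, h1.1, h1.2]

theorem qAddCarry_cost_le (q : ℕ) (x y : List ℕ) (c : ℕ) :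
    (qAddCarry q x y c).cost ≤ x.length + y.length + 2 := by
  induction x generalizing y c with
  | nil =>
    induction y generalizing c with
    | nil =>
      simp only [qAddCarry, cost_bind, digitCmp]
      split <;> simp [digitWrite]
    | cons b bs ih =>
      have := ih ((0 + b + c) / q)
      simp [qAddCarry, digitAdd] at *; omega
  | cons a as ih =>
    cases y with
    | nil =>
      have := ih [] ((a + 0 + c) / q)
      simp [qAddCarry, digitAdd] at *; omega
    | cons b bs =>
      have := ih bs ((a + b + c) / q)
      simp [qAddCarry, digitAdd] at *; omega

/-- Differences may acquire leading zeros, so only value, digit range and length are tracked,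
instead of equality with `Nat.digits`. -/
theorem qSubBorrow_spec {q : ℕ} (x y : List ℕ) (c : ℕ) (hx : IsDigits q x) (hy : IsDigits q y)
    (hl : y.length ≤ x.length) (hc : c ≤ 1) (hle : Nat.ofDigits q y + c ≤ Nat.ofDigits q x) :
    Nat.ofDigits q (qSubBorrow q x y c).val + (Nat.ofDigits q y + c) = Nat.ofDigits q x ∧
      IsDigits q (qSubBorrow q x y c).val ∧ (qSubBorrow q x y c).val.length = x.length ∧
      (qSubBorrow q x y c).cost = x.length := by
  induction x generalizing y c with
  | nil =>
    obtain rfl : y = [] := by simpa using hl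
    simp [qSubBorrow] at *
    exact ⟨hle, fun _ h => by simp at h⟩
  | cons a as ih =>
    rw [isDigits_cons] at hx
    -- One round; an exhausted subtrahend is the case `b = 0`, `bs = []`. The inequality `hle`
    -- passes to the higher digits together with the new borrow.
    have key : ∀ (b : ℕ) (bs : List ℕ), b < q → IsDigits q bs → bs.length ≤ as.length →
        b + q * Nat.ofDigits q bs + c ≤ a + q * Nat.ofDigits q as →
        let s := (digitSub q a b c).val
        let r := qSubBorrow q as bs s.2
        s.1 + q * Nat.ofDigits q r.val + (b + q * Nat.ofDigits q bs + c) =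
            a + q * Nat.ofDigits q as ∧
          s.1 < q ∧ IsDigits q r.val ∧ r.val.length = as.length ∧ r.cost = as.length := by
      intro b bs hb hbs hlen hle
      by_cases hbc : b + c ≤ a
      · have h1 : Nat.ofDigits q bs + 0 ≤ Nat.ofDigits q as := by
          by_contra hcon
          have : q * (Nat.ofDigits q as + 1) ≤ q * Nat.ofDigits q bs :=
            Nat.mul_le_mul_left _ (by omega)
          rw [mul_add] at this
          omega
        have := ih bs 0 hx.2 hbs hlen (by omega) h1
        simp only [digitSub, hbc, if_true]
        obtain ⟨e1, e2, e3, e4⟩ := this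
        refine ⟨?_, by omega, e2, e3, e4⟩
        rw [← e1, mul_add, add_zero]; omega
      · have h1 : Nat.ofDigits q bs + 1 ≤ Nat.ofDigits q as := by
          by_contra hcon
          have : q * Nat.ofDigits q as ≤ q * Nat.ofDigits q bs :=
            Nat.mul_le_mul_left _ (by omega)
          omega
        have := ih bs 1 hx.2 hbs hlen (by omega) h1
        simp only [digitSub, hbc, if_false]
        obtain ⟨e1, e2, e3, e4⟩ := this
        refine ⟨?_, by omega, e2, e3, e4⟩
        rw [← e1, mul_add, mul_add, mul_one]; omega
    cases y with
    | nil =>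
      have := key 0 [] (by omega) (fun _ h => by simp at h) (by simp)
        (by simpa [Nat.ofDigits_cons] using hle)
      obtain ⟨e1, e2, e3, e4, e5⟩ := this
      simp only [qSubBorrow, val_bind, val_pure, cost_bind, cost_pure, Nat.ofDigits_cons,
        isDigits_cons, List.length_cons, e4, e5]
      refine ⟨by simpa using e1, ⟨e2, e3⟩, trivial, ?_⟩
      simp [digitSub]; omega
    | cons b bs =>
      rw [isDigits_cons] at hy
      have := key b bs hy.1 hy.2 (by simpa using hl) (by simpa [Nat.ofDigits_cons] using hle)
      obtain ⟨e1, e2, e3, e4, e5⟩ := this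
      simp only [qSubBorrow, val_bind, val_pure, cost_bind, cost_pure, Nat.ofDigits_cons,
        isDigits_cons, List.length_cons, e4, e5]
      refine ⟨by simpa using e1, ⟨e2, e3⟩, trivial, ?_⟩
      simp [digitSub]; omega

theorem qLessAux_val {q : ℕ} (x y : List ℕ) (r : Bool) (hx : IsDigits q x) (hy : IsDigits q y) :
    (qLessAux x y r).val = true ↔ Nat.ofDigits q x < Nat.ofDigits q y ∨
      (Nat.ofDigits q x = Nat.ofDigits q y ∧ r = true) := by
  -- The higher parts `A`, `B` decide; only on a tie does the verdict updated by `a`, `b` count.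
  have key : ∀ (a b A B : ℕ) (r : Bool), a < q → b < q →
      ((A < B ∨ (A = B ∧ updateVerdict r (compare a b) = true)) ↔
        (a + q * A < b + q * B ∨ (a + q * A = b + q * B ∧ r = true))) := by
    intro a b A B r ha hb
    have lt : ∀ {a b A B : ℕ}, a < q → A < B → a + q * A < b + q * B := by
      intro a b A B ha h
      have : q * (A + 1) ≤ q * B := Nat.mul_le_mul_left _ h
      rw [mul_add] at this
      omega
    rcases lt_trichotomy A B with h | rfl | h
    · have := lt (b := b) ha h
      simp [h, this]
    · rcases lt_trichotomy a b with h | rfl | h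
      · simp [h, Nat.compare_eq_lt.2 h, updateVerdict]
      · simp [updateVerdict]
      · have : compare a b = .gt := Nat.compare_eq_gt.2 h
        simp [this, updateVerdict]; omega
    · have := lt (b := a) hb h
      constructor <;> intro h' <;> omega
  induction x generalizing y r with
  | nil =>
    induction y generalizing r with
    | nil => simp [qLessAux]
    | cons b bs ih =>
      rw [isDigits_cons] at hy
      have hq : 0 < q := by omega
      simp only [qLessAux, val_bind, digitCmp]
      refine (ih _ hy.2).trans ?_
      rw [Nat.ofDigits_cons]
      simpa using key 0 b 0 (Nat.ofDigits q bs) r hq hy.1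
  | cons a as ih =>
    rw [isDigits_cons] at hx
    have hq : 0 < q := by omega
    cases y with
    | nil =>
      simp only [qLessAux, val_bind, digitCmp]
      refine (ih _ _ hx.2 hy).trans ?_
      rw [Nat.ofDigits_cons]
      simpa using key a 0 (Nat.ofDigits q as) 0 r hx.1 hq
    | cons b bs =>
      rw [isDigits_cons] at hy
      simp only [qLessAux, val_bind, digitCmp]
      refine (ih _ _ hx.2 hy.2).trans ?_
      rw [Nat.ofDigits_cons, Nat.ofDigits_cons]
      simpa using key a b (Nat.ofDigits q as) (Nat.ofDigits q bs) r hx.1 hy.1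

theorem qLess_val {q : ℕ} {x y : List ℕ} (hx : IsDigits q x) (hy : IsDigits q y) :
    (qLess x y).val = true ↔ Nat.ofDigits q x < Nat.ofDigits q y := by
  simp [qLess, qLessAux_val x y false hx hy]

theorem qLessAux_cost_le (x y : List ℕ) (r : Bool) :
    (qLessAux x y r).cost ≤ x.length + y.length := by
  induction x generalizing y r with
  | nil =>
    induction y generalizing r with
    | nil => simp [qLessAux]
    | cons b bs ih =>
      have := ih (updateVerdict r (compare 0 b))
      simp [qLessAux, digitCmp] at *; omega
  | cons a as ih =>
    cases y with
    | nil =>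
      have := ih [] (updateVerdict r (compare a 0))
      simp [qLessAux, digitCmp] at *; omega
    | cons b bs =>
      have := ih bs (updateVerdict r (compare a b))
      simp [qLessAux, digitCmp] at *; omega

theorem qLess_cost_le (x y : List ℕ) : (qLess x y).cost ≤ x.length + y.length :=
  qLessAux_cost_le x y false

/-- A number without leading zeros is not longer than a list of digits with at least its value. -/
theorem length_le_of_ofDigits_le {q : ℕ} (hq : 2 ≤ q) {x : List ℕ} (hx : IsDigits q x) (m a : ℕ)
    (ha : 0 < a) (h : a * q ^ m ≤ Nat.ofDigits q x) :
    m + (Nat.digits q a).length ≤ x.length := by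
  have h1 : Nat.ofDigits q x < q ^ x.length :=
    Nat.ofDigits_lt_base_pow_length (by omega) fun d hd => hx d hd
  have h2 : q ^ ((Nat.digits q a).length - 1) ≤ a := by
    rw [Nat.length_digits q a (by omega) (by omega), Nat.add_sub_cancel]
    exact Nat.pow_log_le_self q (by omega)
  have h3 : q ^ (m + ((Nat.digits q a).length - 1)) < q ^ x.length := by
    rw [pow_add, mul_comm]
    exact lt_of_le_of_lt (Nat.mul_le_mul_right _ h2) (lt_of_le_of_lt h h1)
  have h4 := (Nat.pow_lt_pow_iff_right (by omega)).1 h3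
  omega

theorem qSub_spec {q : ℕ} {x y : List ℕ} (hx : IsDigits q x) (hy : IsDigits q y)
    (hl : y.length ≤ x.length) (hle : Nat.ofDigits q y ≤ Nat.ofDigits q x) :
    Nat.ofDigits q (qSub q x y).val + Nat.ofDigits q y = Nat.ofDigits q x ∧
      IsDigits q (qSub q x y).val ∧ (qSub q x y).val.length = x.length ∧
      (qSub q x y).cost = x.length :=
  qSubBorrow_spec x y 0 hx hy hl (by omega) (by omega)

theorem idxLen_le_self {q : ℕ} (hq : 2 ≤ q) (a : ℕ) : idxLen q a ≤ a := by
  rcases Nat.eq_zero_or_pos a with rfl | ha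
  · simp [idxLen]
  · rw [idxLen, Nat.length_digits q a (by omega) (by omega)]
    exact Nat.log_lt_self q (by omega)

/-- Base `2` is the worst case; this is what makes the constant independent of `q`. -/
theorem length_digits_le {q : ℕ} (hq : 2 ≤ q) {a t : ℕ} (h : a < 2 ^ t) :
    (Nat.digits q a).length ≤ t := by
  rw [Nat.digits_length_le_iff (by omega)]
  exact lt_of_lt_of_le h (Nat.pow_le_pow_left hq t)

end Counted

/-! ### Partition numbers in a box and their generating polynomial -/

open Polynomial in
/-- The generating polynomial of the partitions whose diagrams fit into an `a × b` box. -/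
noncomputable def boxPoly : ℕ → ℕ → Polynomial ℕ
  | 0, _ => 1
  | _ + 1, 0 => 1
  | a + 1, b + 1 => X ^ (a + 1) * boxPoly (a + 1) b + boxPoly a (b + 1)

/-- The number of partitions of `m` whose diagrams fit into an `a × b` box. -/
noncomputable def boxCount (a b m : ℕ) : ℕ := (boxPoly a b).coeff m

@[simp] theorem boxPoly_zero_left (b : ℕ) : boxPoly 0 b = 1 := by simp [boxPoly]

@[simp] theorem boxPoly_zero_right (a : ℕ) : boxPoly a 0 = 1 := by cases a <;> simp [boxPoly]

/-- Either the first column has full height `a + 1`, and removing it leaves an `(a + 1) × b` box, or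
the diagram fits into an `a × (b + 1)` box. -/
theorem boxCount_succ (a b m : ℕ) : boxCount (a + 1) (b + 1) m =
    (if a + 1 ≤ m then boxCount (a + 1) b (m - (a + 1)) else 0) + boxCount a (b + 1) m := by
  simp only [boxCount, boxPoly, Polynomial.coeff_add, Polynomial.coeff_X_pow_mul']

theorem boxCount_zero_left (b m : ℕ) : boxCount 0 b m = if m = 0 then 1 else 0 := by
  simp [boxCount, Polynomial.coeff_one]

theorem boxCount_zero_right (a m : ℕ) : boxCount a 0 m = if m = 0 then 1 else 0 := by
  simp [boxCount, Polynomial.coeff_one]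

theorem boxCount_zero (a b : ℕ) : boxCount a b 0 = 1 := by
  induction a with
  | zero => simp [boxCount_zero_left]
  | succ a ih =>
    cases b with
    | zero => simp [boxCount_zero_right]
    | succ b =>
      have : boxCount a (b + 1) 0 = 1 := ih
      simp [boxCount_succ, this]

/-- Used in the main loop: for `α_m = 0` the shifted list would be a string of `m` zeros, possibly
longer than the minuend. -/
theorem boxCount_pos (a b m : ℕ) (h : m ≤ a * b) : 0 < boxCount a b m := by
  induction a generalizing b m with
  | zero => simp at h; simp [h, boxCount_zero]
  | succ a iha =>
    induction b generalizing m with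
    | zero => simp at h; simp [h, boxCount_zero]
    | succ b ihb =>
      rw [boxCount_succ]
      by_cases hm : a + 1 ≤ m
      · rw [if_pos hm]
        have := ihb (m - (a + 1)) (by rw [mul_add, mul_one] at h; omega)
        omega
      · have := iha (b + 1) m (by
          rcases Nat.eq_zero_or_pos a with rfl | ha
          · omega
          · exact le_trans (by omega) (Nat.le_mul_of_pos_right a (Nat.succ_pos b)))
        omega

theorem natDegree_boxPoly_le (a b : ℕ) : (boxPoly a b).natDegree ≤ a * b := by
  induction a generalizing b with
  | zero => simp
  | succ a iha =>
    induction b with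
    | zero => simp
    | succ b ihb =>
      rw [boxPoly]
      refine (Polynomial.natDegree_add_le _ _).trans (max_le ?_ ?_)
      · refine Polynomial.natDegree_mul_le.trans ?_
        rw [Polynomial.natDegree_X_pow]
        nlinarith
      · exact (iha _).trans (by nlinarith)

theorem sum_boxCount_mul_pow (a b q : ℕ) :
    ∑ m ∈ Finset.range (a * b + 1), boxCount a b m * q ^ m = (boxPoly a b).eval q :=
  (Polynomial.eval_eq_sum_range' (Nat.lt_succ_of_le (natDegree_boxPoly_le a b)) q).symm

/-- Each use of the recurrence at most doubles the bound, and `2 ≤ q` absorbs this in one more power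
of `q`. It bounds the number of digits of the input index. -/
theorem eval_boxPoly_le {q : ℕ} (hq : 2 ≤ q) (a b : ℕ) :
    (boxPoly a b).eval q ≤ q ^ (a * b + a + b) := by
  induction a generalizing b with
  | zero => simpa using Nat.one_le_pow _ _ (by omega)
  | succ a iha =>
    induction b with
    | zero => simpa using Nat.one_le_pow _ _ (by omega)
    | succ b ihb =>
      simp only [boxPoly, Polynomial.eval_add, Polynomial.eval_mul, Polynomial.eval_pow,
        Polynomial.eval_X]
      have h1 : q ^ (a + 1) * (boxPoly (a + 1) b).eval q ≤
          q ^ ((a + 1) * (b + 1) + (a + 1) + b) := by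
        refine (Nat.mul_le_mul_left _ ihb).trans (le_of_eq ?_)
        rw [← pow_add]; congr 1; ring
      have h2 : (boxPoly a (b + 1)).eval q ≤ q ^ ((a + 1) * (b + 1) + (a + 1) + b) :=
        (iha (b + 1)).trans (Nat.pow_le_pow_right (by omega) (by nlinarith))
      calc _ ≤ q ^ ((a + 1) * (b + 1) + (a + 1) + b) * 2 := by omega
        _ ≤ q ^ ((a + 1) * (b + 1) + (a + 1) + b) * q := Nat.mul_le_mul_left _ hq
        _ = _ := by rw [← pow_succ]; rfl

/-! ### The Gaussian coefficient -/

theorem gaussCoeff_mul_prod {q : ℕ} (hq : 2 ≤ q) (n k : ℕ) :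
    gaussCoeff q n k * ∏ i ∈ Finset.range k, ((q : ℚ) ^ (i + 1) - 1) =
      ∏ i ∈ Finset.range k, ((q : ℚ) ^ (n - i) - 1) := by
  have h : ∏ i ∈ Finset.range k, ((q : ℚ) ^ (k - i) - 1) =
      ∏ i ∈ Finset.range k, ((q : ℚ) ^ (i + 1) - 1) := by
    rw [← Finset.prod_range_reflect]
    refine Finset.prod_congr rfl fun i hi => ?_
    have := Finset.mem_range.1 hi
    congr 2; omega
  have h0 : ∏ i ∈ Finset.range k, ((q : ℚ) ^ (i + 1) - 1) ≠ 0 := by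
    refine Finset.prod_ne_zero_iff.2 fun i _ => sub_ne_zero.2 (ne_of_gt ?_)
    exact one_lt_pow₀ (by exact_mod_cast (by omega : 1 < q)) (by omega)
  rw [gaussCoeff, Finset.prod_div_distrib, h, div_mul_cancel₀ _ h0]

/-- With denominators cleared and a common product split off, the recurrence reduces to `q^(a+1)
(q^(b+1) - 1) + (q^(a+1) - 1) = q^(a+b+2) - 1`. -/
theorem eval_boxPoly_mul_prod {q : ℕ} (a b : ℕ) :
    (((boxPoly a b).eval q : ℕ) : ℚ) * ∏ i ∈ Finset.range a, ((q : ℚ) ^ (i + 1) - 1) =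
      ∏ i ∈ Finset.range a, ((q : ℚ) ^ (b + 1 + i) - 1) := by
  induction a generalizing b with
  | zero => simp
  | succ a iha =>
    induction b with
    | zero =>
      rw [boxPoly_zero_right, Polynomial.eval_one, Nat.cast_one, one_mul]
      exact Finset.prod_congr rfl fun i _ => by rw [zero_add, add_comm 1 i]
    | succ b ihb =>
      rw [boxPoly, Polynomial.eval_add, Polynomial.eval_mul, Polynomial.eval_pow,
        Polynomial.eval_X]
      push_cast
      rw [add_mul, mul_assoc, ihb, Finset.prod_range_succ (fun i => (q : ℚ) ^ (i + 1) - 1),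
        ← mul_assoc, iha, Finset.prod_range_succ' (fun i => (q : ℚ) ^ (b + 1 + i) - 1),
        Finset.prod_range_succ (fun i => (q : ℚ) ^ (b + 1 + 1 + i) - 1)]
      rw [Finset.prod_congr rfl fun i _ => by rw [show b + 1 + (i + 1) = b + 1 + 1 + i by ring]]
      ring

theorem eval_boxPoly_eq_gaussCoeff {q : ℕ} (hq : 2 ≤ q) {n k : ℕ} (hk : k ≤ n) :
    (((boxPoly k (n - k)).eval q : ℕ) : ℚ) = gaussCoeff q n k := by
  have h0 : ∏ i ∈ Finset.range k, ((q : ℚ) ^ (i + 1) - 1) ≠ 0 := by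
    refine Finset.prod_ne_zero_iff.2 fun i _ => sub_ne_zero.2 (ne_of_gt ?_)
    exact one_lt_pow₀ (by exact_mod_cast (by omega : 1 < q)) (by omega)
  refine mul_right_cancel₀ h0 ?_
  rw [gaussCoeff_mul_prod hq, eval_boxPoly_mul_prod, ← Finset.prod_range_reflect]
  refine Finset.prod_congr rfl fun i hi => ?_
  have := Finset.mem_range.1 hi
  congr 2; omega

/-! ### A subexponential bound for partition numbers -/

theorem one_le_prod_range (f : ℕ → ℝ) (a : ℕ) (h : ∀ i, 1 ≤ f i) :
    1 ≤ ∏ i ∈ Finset.range a, f i := by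
  induction a with
  | zero => simp
  | succ a ih => rw [Finset.prod_range_succ]; exact one_le_mul_of_one_le_of_one_le ih (h a)

/-- The right side `P a` is the generating function of partitions into parts at most `a`. The
induction runs on `P (a + 1) = x ^ (a + 1) * P (a + 1) + P a`, which mirrors the recurrence. -/
theorem boxCount_mul_pow_le (x : ℝ) (hx0 : 0 < x) (hx1 : x < 1) (a b m : ℕ) :
    (boxCount a b m : ℝ) * x ^ m ≤ ∏ i ∈ Finset.range a, (1 - x ^ (i + 1))⁻¹ := by
  have hpos : ∀ i : ℕ, 0 < 1 - x ^ (i + 1) := fun i =>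
    sub_pos.2 (pow_lt_one₀ hx0.le hx1 (by omega))
  have hone : ∀ a : ℕ, 1 ≤ ∏ i ∈ Finset.range a, (1 - x ^ (i + 1))⁻¹ := fun a =>
    one_le_prod_range _ _ fun i => (one_le_inv₀ (hpos i)).2 (by
      have := pow_pos hx0 (i + 1); linarith)
  induction a generalizing b m with
  | zero =>
    rw [boxCount_zero_left]
    split
    · simp [*]
    · simp
  | succ a iha =>
    induction b generalizing m with
    | zero =>
      rw [boxCount_zero_right]
      split
      · simpa [*] using hone (a + 1)
      · simpa using zero_le_one.trans (hone (a + 1))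
    | succ b ihb =>
      have h2 := iha (b + 1) m
      have h1 : ((if a + 1 ≤ m then boxCount (a + 1) b (m - (a + 1)) else 0 : ℕ) : ℝ) * x ^ m ≤
          x ^ (a + 1) * ∏ i ∈ Finset.range (a + 1), (1 - x ^ (i + 1))⁻¹ := by
        split
        · have := mul_le_mul_of_nonneg_left (ihb (m - (a + 1))) (pow_nonneg hx0.le (a + 1))
          refine le_trans (le_of_eq ?_) this
          rw [mul_left_comm, ← pow_add]
          congr 2; omega
        · have := hone (a + 1)
          simp only [Nat.cast_zero, zero_mul]
          positivity
      rw [boxCount_succ, Nat.cast_add, add_mul]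
      refine (add_le_add h1 h2).trans (le_of_eq ?_)
      rw [Finset.prod_range_succ]
      have := (hpos a).ne'
      field_simp
      ring

/-- Bernoulli's inequality bounds the factor with index `i` by `(s + i + 1) / (i + 1)`. The first
`s` of these bounds multiply to the binomial coefficient of `2 s` over `s`, at most `4 ^ s`. Every
later factor is at most `2`, hence at most `exp (2 x ^ (i + 1))`, and the geometric series
contributes at most `1 / (1 - x) = s + 1`. -/
theorem prod_inv_one_sub_pow_le (s : ℕ) (hs : 0 < s) (a : ℕ) :
    ∏ i ∈ Finset.range a, (1 - ((s : ℝ) / (s + 1)) ^ (i + 1))⁻¹ ≤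
      4 ^ s * Real.exp (2 * (s + 1)) := by
  set x : ℝ := (s : ℝ) / (s + 1) with hx
  have hs' : (0 : ℝ) < s := by exact_mod_cast hs
  have hx0 : 0 < x := by positivity
  have hx1 : x < 1 := by rw [hx, div_lt_one (by positivity)]; linarith
  have hpos : ∀ i : ℕ, 0 < 1 - x ^ (i + 1) := fun i =>
    sub_pos.2 (pow_lt_one₀ hx0.le hx1 (by omega))
  have hfac : ∀ i : ℕ, (1 - x ^ (i + 1))⁻¹ ≤ ((s : ℝ) + (i + 1)) / (i + 1) := by
    intro i
    have hb := one_add_mul_le_pow (a := 1 / (s : ℝ)) (by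
      have : 0 < 1 / (s : ℝ) := by positivity
      linarith) (i + 1)
    have hxi : x ^ (i + 1) = ((1 + 1 / (s : ℝ)) ^ (i + 1))⁻¹ := by
      rw [← inv_pow]; congr 1; rw [hx]; field_simp
    have h2 : x ^ (i + 1) ≤ (1 + ((i : ℝ) + 1) * (1 / s))⁻¹ := by
      rw [hxi]
      refine inv_anti₀ (by positivity) ?_
      simpa using hb
    have h3 : (1 + ((i : ℝ) + 1) * (1 / s))⁻¹ = 1 - (i + 1) / (s + (i + 1)) := by
      field_simp; ring
    rw [inv_le_comm₀ (hpos i) (by positivity), inv_div]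
    rw [h3] at h2; linarith
  have hlow : ∀ t : ℕ, ∏ i ∈ Finset.range t, ((s : ℝ) + (i + 1)) / (i + 1) =
      ((s + t).choose t : ℕ) := by
    intro t
    induction t with
    | zero => simp
    | succ t ih =>
      rw [Finset.prod_range_succ, ih]
      have h := Nat.add_one_mul_choose_eq (s + t) t
      have h' : ((s : ℝ) + t + 1) * ((s + t).choose t : ℕ) =
          ((s + t + 1).choose (t + 1) : ℕ) * (t + 1) := by exact_mod_cast h
      rw [← add_assoc s t 1]
      field_simp
      linarith
  have hhigh : ∀ i : ℕ, s ≤ i → (1 - x ^ (i + 1))⁻¹ ≤ Real.exp (2 * x ^ (i + 1)) := by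
    intro i hi
    have hi' : (s : ℝ) ≤ i := by exact_mod_cast hi
    have h1 := hfac i
    have h2 : ((s : ℝ) + (i + 1)) / (i + 1) ≤ 2 := by
      rw [div_le_iff₀ (by positivity)]; linarith
    have h3 : (1 - x ^ (i + 1))⁻¹ = 1 + x ^ (i + 1) * (1 - x ^ (i + 1))⁻¹ := by
      have := (hpos i).ne'
      field_simp; ring
    have h4 := Real.add_one_le_exp (2 * x ^ (i + 1))
    have h5 : x ^ (i + 1) * (1 - x ^ (i + 1))⁻¹ ≤ x ^ (i + 1) * 2 :=
      mul_le_mul_of_nonneg_left (h1.trans h2) (by positivity)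
    linarith
  have hone : ∀ i : ℕ, 1 ≤ (1 - x ^ (i + 1))⁻¹ := fun i =>
    (one_le_inv₀ (hpos i)).2 (by have := pow_pos hx0 (i + 1); linarith)
  have hgeom : ∑ i ∈ Finset.range a, x ^ i ≤ s + 1 := by
    have h := geom_sum_mul_neg x a
    have h1 : 1 - x = 1 / (s + 1) := by rw [hx]; field_simp; ring
    rw [h1, mul_one_div, div_eq_iff (by positivity)] at h
    have := pow_pos hx0 a
    nlinarith
  calc ∏ i ∈ Finset.range a, (1 - x ^ (i + 1))⁻¹
      ≤ ∏ i ∈ Finset.range (s + a), (1 - x ^ (i + 1))⁻¹ := by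
        rw [add_comm s a, Finset.prod_range_add]
        exact le_mul_of_one_le_right (Finset.prod_nonneg fun i _ => zero_le_one.trans (hone i))
          (one_le_prod_range _ _ fun i => hone _)
    _ = (∏ i ∈ Finset.range s, (1 - x ^ (i + 1))⁻¹) *
          ∏ i ∈ Finset.range a, (1 - x ^ (s + i + 1))⁻¹ := Finset.prod_range_add _ _ _
    _ ≤ 4 ^ s * Real.exp (2 * (s + 1)) := by
        refine mul_le_mul ?_ ?_ (Finset.prod_nonneg fun i _ => zero_le_one.trans (hone _))
          (by positivity)
        · calc _ ≤ ∏ i ∈ Finset.range s, ((s : ℝ) + (i + 1)) / (i + 1) :=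
                Finset.prod_le_prod (fun i _ => zero_le_one.trans (hone i)) fun i _ => hfac i
            _ = ((s + s).choose s : ℕ) := hlow s
            _ ≤ 4 ^ s := by
                have : (s + s).choose s ≤ 2 ^ (s + s) := Nat.choose_le_two_pow _ _
                rw [← two_mul, pow_mul] at this
                rw [← two_mul]
                exact_mod_cast this
        · calc _ ≤ ∏ i ∈ Finset.range a, Real.exp (2 * x ^ i) := by
                refine Finset.prod_le_prod (fun i _ => zero_le_one.trans (hone _)) fun i _ => ?_
                refine (hhigh (s + i) (by omega)).trans (Real.exp_le_exp.2 ?_)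
                have := pow_le_pow_of_le_one hx0.le hx1.le (show i ≤ s + i + 1 by omega)
                linarith
            _ = Real.exp (2 * ∑ i ∈ Finset.range a, x ^ i) := by
                rw [← Real.exp_sum, Finset.mul_sum]
            _ ≤ _ := Real.exp_le_exp.2 (by linarith)

/-- At `x = s / (s + 1)` one has `x ^ m ≥ exp (-m / s) ≥ exp (-s)`, so the coefficient is at most `4
^ s * exp (3 s + 2)`; then `e < 4`. -/
theorem boxCount_le_two_pow (s : ℕ) (hs : 0 < s) (a b m : ℕ) (hm : m ≤ s * s) :
    boxCount a b m ≤ 2 ^ (8 * s + 4) := by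
  have hs' : (0 : ℝ) < s := by exact_mod_cast hs
  have hx0 : 0 < (s : ℝ) / (s + 1) := by positivity
  have hx1 : (s : ℝ) / (s + 1) < 1 := by rw [div_lt_one (by positivity)]; linarith
  have h1 := (boxCount_mul_pow_le _ hx0 hx1 a b m).trans (prod_inv_one_sub_pow_le s hs a)
  have h2 : Real.exp (-s) ≤ ((s : ℝ) / (s + 1)) ^ m := by
    have h3 : Real.exp (-(1 / s)) ≤ (s : ℝ) / (s + 1) := by
      rw [Real.exp_neg, inv_le_comm₀ (Real.exp_pos _) hx0, inv_div]
      have := Real.add_one_le_exp (1 / (s : ℝ))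
      refine le_trans (le_of_eq ?_) this
      field_simp
      ring
    calc Real.exp (-s) ≤ Real.exp (m * -(1 / s)) := by
          refine Real.exp_le_exp.2 ?_
          have : (m : ℝ) ≤ s * s := by exact_mod_cast hm
          have h4 : (m : ℝ) * (1 / s) ≤ s := by
            rw [mul_one_div, div_le_iff₀ hs']; exact this
          linarith
      _ = Real.exp (-(1 / s)) ^ m := by rw [Real.exp_nat_mul]
      _ ≤ _ := pow_le_pow_left₀ (Real.exp_pos _).le h3 m
  have h5 : (boxCount a b m : ℝ) ≤ 4 ^ s * Real.exp (2 * (s + 1)) * Real.exp s := by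
    have h6 := (mul_le_mul_of_nonneg_left h2 (Nat.cast_nonneg (boxCount a b m))).trans h1
    rw [Real.exp_neg, ← div_eq_mul_inv, div_le_iff₀ (Real.exp_pos _)] at h6
    exact h6
  have h7 : Real.exp (2 * (s + 1)) * Real.exp s ≤ 4 ^ (3 * s + 2) := by
    rw [← Real.exp_add]
    have : (2 * ((s : ℝ) + 1) + s) = ((3 * s + 2 : ℕ) : ℝ) * 1 := by push_cast; ring
    rw [this, Real.exp_nat_mul]
    exact pow_le_pow_left₀ (Real.exp_pos _).le (by linarith [Real.exp_one_lt_d9]) _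
  have h8 : (boxCount a b m : ℝ) ≤ 2 ^ (8 * s + 4) := by
    refine h5.trans ?_
    rw [mul_assoc]
    refine (mul_le_mul_of_nonneg_left h7 (by positivity)).trans (le_of_eq ?_)
    rw [show (4 : ℝ) = 2 ^ 2 by norm_num, ← pow_mul, ← pow_mul, ← pow_add]
    congr 1; ring
  exact_mod_cast h8

/-! ### The rank of a Ferrers tableaux form -/

/-- `D` lists nonincreasing column heights, the first of them at most `a`. -/
def IsDiagram : ℕ → List ℕ → Prop
  | _, [] => True
  | a, d :: D => d ≤ a ∧ IsDiagram d D

/-- The number of diagrams of size `M` with `b + 1` columns of which the first has height `c`. -/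
noncomputable def colCount (b M c : ℕ) : ℕ := if c ≤ M then boxCount c b (M - c) else 0

/-- The number of diagrams of the same size that precede `D` and whose columns have height at
most `a`. -/
noncomputable def diagRank : ℕ → List ℕ → ℕ
  | _, [] => 0
  | a, d :: D => ∑ c ∈ Finset.Ioc d a, colCount D.length (d + D.sum) c + diagRank d D

theorem boxCount_succ_eq_colCount (a b M : ℕ) :
    boxCount (a + 1) (b + 1) M = colCount b M (a + 1) + boxCount a (b + 1) M :=
  boxCount_succ a b M

theorem boxCount_zero_eq_colCount (b M : ℕ) : boxCount 0 (b + 1) M = colCount b M 0 := by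
  simp [colCount, boxCount_zero_left]

theorem colCount_le_boxCount (b M c : ℕ) : colCount b M c ≤ boxCount c (b + 1) M := by
  cases c with
  | zero => rw [boxCount_zero_eq_colCount]
  | succ c => rw [boxCount_succ_eq_colCount]; omega

/-- Iterating the recurrence in the height sorts diagrams by their first column; the while loop
subtracts exactly these summands. -/
theorem sum_colCount_add (b M d a : ℕ) (h : d ≤ a) :
    ∑ c ∈ Finset.Ioc d a, colCount b M c + boxCount d (b + 1) M = boxCount a (b + 1) M := by
  induction a, h using Nat.le_induction with
  | base => simp
  | succ a h ih =>
    rw [Finset.sum_Ioc_succ_top (by omega), boxCount_succ_eq_colCount]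
    omega

theorem diagRank_lt_boxCount (a : ℕ) (D : List ℕ) (h : IsDiagram a D) :
    diagRank a D < boxCount a D.length D.sum := by
  induction D generalizing a with
  | nil => simp [diagRank, boxCount_zero]
  | cons d D ih =>
    have h1 := ih d h.2
    have h2 := colCount_le_boxCount D.length (d + D.sum) d
    have h3 := sum_colCount_add D.length (d + D.sum) d a h.1
    simp only [colCount, Nat.le_add_right, if_true, Nat.add_sub_cancel_left] at h2
    simp only [diagRank, List.length_cons, List.sum_cons]
    omega

theorem diagRank_lt_of_lex (a : ℕ) (D D' : List ℕ) (h : IsDiagram a D)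
    (hl : D.length = D'.length) (hs : D.sum = D'.sum) (hlex : List.Lex (fun a b => b < a) D D') :
    diagRank a D < diagRank a D' := by
  induction hlex generalizing a with
  | nil => simp at hl
  | @cons d D D' _ ih =>
    have hl' : D.length = D'.length := by simpa using hl
    have hs' : D.sum = D'.sum := by simpa using hs
    have := ih d h.2 hl' hs'
    simp only [diagRank, hl', hs']
    omega
  | @rel d D d' D' hd =>
    have hl' : D.length = D'.length := by simpa using hl
    have hs' : d + D.sum = d' + D'.sum := by simpa using hs
    have h1 := diagRank_lt_boxCount d D h.2
    have h2 : boxCount d D.length D.sum = colCount D.length (d + D.sum) d := by simp [colCount]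
    -- As `d' < d`, the rank of `D'` contains the whole summand `c = d`, which exceeds what the
    -- later columns contribute to the rank of `D`.
    have h3 : ∑ c ∈ insert d (Finset.Ioc d a), colCount D.length (d + D.sum) c ≤
        ∑ c ∈ Finset.Ioc d' a, colCount D.length (d + D.sum) c := by
      refine Finset.sum_le_sum_of_subset fun c hc => ?_
      have := h.1
      simp only [Finset.mem_insert, Finset.mem_Ioc] at hc ⊢
      omega
    rw [Finset.sum_insert (by simp)] at h3
    simp only [diagRank, ← hl', ← hs']
    omega

theorem lex_or_lex_of_ne (D D' : List ℕ) (hl : D.length = D'.length) (h : D ≠ D') :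
    List.Lex (fun a b => b < a) D D' ∨ List.Lex (fun a b => b < a) D' D := by
  induction D generalizing D' with
  | nil => cases D' <;> simp_all
  | cons d D ih =>
    cases D' with
    | nil => simp at hl
    | cons d' D' =>
      rcases lt_trichotomy d d' with hd | rfl | hd
      · exact .inr (.rel hd)
      · rcases ih D' (by simpa using hl) (by simpa using h) with h' | h'
        · exact .inl (.cons h')
        · exact .inr (.cons h')
      · exact .inl (.rel hd)

/-- `(D, x)` has the shape of a Ferrers tableaux form in a `k × η` box. -/
structure IsForm (q k η : ℕ) (D x : List ℕ) : Prop where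
  length_diagram : D.length = η
  isDiagram : IsDiagram k D
  length_entries : x.length = D.sum
  isDigits : Counted.IsDigits q x

theorem IsDiagram.sum_le {a : ℕ} {D : List ℕ} (h : IsDiagram a D) : D.sum ≤ a * D.length := by
  induction D generalizing a with
  | nil => simp
  | cons d D ih =>
    have h1 := ih h.2
    have h2 := Nat.mul_le_mul_right D.length h.1
    rw [List.sum_cons, List.length_cons, mul_add, mul_one]
    have := h.1
    omega

/-- The number of tableaux forms with fewer than `c` dots. -/
noncomputable def smallCount (q k η c : ℕ) : ℕ := ∑ m ∈ Finset.range c, boxCount k η m * q ^ m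

theorem smallCount_succ (q k η c : ℕ) :
    smallCount q k η (c + 1) = smallCount q k η c + boxCount k η c * q ^ c :=
  Finset.sum_range_succ _ _

theorem smallCount_mono (q k η : ℕ) {c d : ℕ} (h : c ≤ d) :
    smallCount q k η c ≤ smallCount q k η d :=
  Finset.sum_le_sum_of_subset (Finset.range_mono h)

/-- The rank of the tableaux form `(D, x)` in the order `TableauxLT`. -/
noncomputable def formRank (q k η : ℕ) (D x : List ℕ) : ℕ :=
  smallCount q k η (k * η + 1) - smallCount q k η (D.sum + 1) + diagRank k D * q ^ D.sum +
    vecValue q x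

section FormRank

variable {q k η : ℕ} {D x D' x' : List ℕ}

theorem IsForm.sum_le (h : IsForm q k η D x) : D.sum ≤ k * η := by
  rw [← h.length_diagram]; exact h.isDiagram.sum_le

theorem IsForm.vecValue_lt (h : IsForm q k η D x) (hq : 2 ≤ q) : vecValue q x < q ^ D.sum := by
  rw [← h.length_entries, ← List.length_reverse]
  exact Nat.ofDigits_lt_base_pow_length (by omega) fun d hd => h.isDigits d (by simpa using hd)

theorem IsForm.value_lt (h : IsForm q k η D x) (hq : 2 ≤ q) :
    diagRank k D * q ^ D.sum + vecValue q x < boxCount k η D.sum * q ^ D.sum := by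
  have h1 := diagRank_lt_boxCount k D h.isDiagram
  rw [h.length_diagram] at h1
  have h2 := Nat.mul_le_mul_right (q ^ D.sum) h1
  have h3 := h.vecValue_lt hq
  rw [Nat.succ_eq_add_one, add_mul] at h2
  omega

/-- The rank is a number in mixed radix: the entries stay below `q ^ D.sum`, and diagram part and
entries together stay below the size of the block of forms with `D.sum` dots. -/
theorem IsForm.formRank_lt (hq : 2 ≤ q) (h : IsForm q k η D x) (h' : IsForm q k η D' x')
    (hlt : TableauxLT q D x D' x') : formRank q k η D x < formRank q k η D' x' := by
  unfold formRank
  rcases hlt with hs | ⟨hs, hlex⟩ | ⟨rfl, hx⟩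
  · have h1 := h.value_lt hq
    have h2 := smallCount_succ q k η D.sum
    have h3 := smallCount_mono q k η (show D'.sum + 1 ≤ D.sum by omega)
    -- This rules out truncation of the natural subtraction in `formRank`.
    have h4 := smallCount_mono q k η (show D.sum + 1 ≤ k * η + 1 by have := h.sum_le; omega)
    omega
  · have h1 := diagRank_lt_of_lex k D D' h.isDiagram
      (h.length_diagram.trans h'.length_diagram.symm) hs hlex
    have h2 := Nat.mul_le_mul_right (q ^ D.sum) h1
    have h3 := h.vecValue_lt hq
    rw [Nat.succ_eq_add_one, add_mul, one_mul] at h2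
    rw [← hs]
    omega
  · omega

theorem IsForm.tableauxLT_or (hq : 2 ≤ q) (h : IsForm q k η D x) (h' : IsForm q k η D' x')
    (hne : ¬(D = D' ∧ x = x')) : TableauxLT q D x D' x' ∨ TableauxLT q D' x' D x := by
  rcases lt_trichotomy D.sum D'.sum with hs | hs | hs
  · exact .inr (.inl hs)
  · by_cases hD : D = D'
    · subst hD
      have hv : vecValue q x ≠ vecValue q x' := by
        intro hv
        have := Nat.ofDigits_inj_of_len_eq (by omega : 1 < q)
          (by rw [List.length_reverse, List.length_reverse, h.length_entries, h'.length_entries])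
          (fun d hd => h.isDigits d (by simpa using hd))
          (fun d hd => h'.isDigits d (by simpa using hd)) hv
        exact hne ⟨rfl, List.reverse_injective this⟩
      rcases lt_or_gt_of_ne hv with hv | hv
      · exact .inl (.inr (.inr ⟨rfl, hv⟩))
      · exact .inr (.inr (.inr ⟨rfl, hv⟩))
    · rcases lex_or_lex_of_ne D D' (h.length_diagram.trans h'.length_diagram.symm) hD with hl | hl
      · exact .inl (.inr (.inl ⟨hs, hl⟩))
      · exact .inr (.inr (.inl ⟨hs.symm, hl⟩))
  · exact .inl (.inl hs)

theorem IsForm.tableauxLT_iff (hq : 2 ≤ q) (h : IsForm q k η D x) (h' : IsForm q k η D' x') :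
    TableauxLT q D x D' x' ↔ formRank q k η D x < formRank q k η D' x' := by
  refine ⟨h.formRank_lt hq h', fun hlt => ?_⟩
  by_cases he : D = D' ∧ x = x'
  · rw [he.1, he.2] at hlt; exact absurd hlt (lt_irrefl _)
  · refine (h.tableauxLT_or hq h' he).resolve_right fun hr => ?_
    exact absurd (h'.formRank_lt hq h hr) (by omega)

theorem IsForm.formRank_injective (hq : 2 ≤ q) (h : IsForm q k η D x) (h' : IsForm q k η D' x')
    (he : formRank q k η D x = formRank q k η D' x') : D = D' ∧ x = x' := by
  by_contra hne
  rcases h.tableauxLT_or hq h' hne with hlt | hlt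
  · have := h.formRank_lt hq h' hlt; omega
  · have := h'.formRank_lt hq h hlt; omega

end FormRank

/-! ### Reduced row echelon forms and Ferrers diagrams -/

section Columns

variable {n k : ℕ}

theorem mem_freeColumns {piv : Fin k → Fin n} {c : Fin n} :
    c ∈ freeColumns piv ↔ ∀ r, piv r ≠ c := by
  simp [freeColumns]

theorem mem_rowsBefore {piv : Fin k → Fin n} {c : Fin n} {r : Fin k} :
    r ∈ rowsBefore piv c ↔ piv r < c := by
  simp [rowsBefore]

theorem pairwise_freeColumns (piv : Fin k → Fin n) : (freeColumns piv).Pairwise (· > ·) :=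
  (List.pairwise_reverse.2 (List.pairwise_lt_finRange n)).filter _

theorem nodup_freeColumns (piv : Fin k → Fin n) : (freeColumns piv).Nodup :=
  (pairwise_freeColumns piv).imp fun h => ne_of_gt h

theorem nodup_rowsBefore (piv : Fin k → Fin n) (c : Fin n) : (rowsBefore piv c).Nodup :=
  (List.nodup_finRange k).filter _

/-- The `c` columns to the left of `c` are either pivot columns, one for each row in `rowsBefore piv
c`, or free columns, listed by `L`. -/
theorem length_rowsBefore_add {piv : Fin k → Fin n} (hp : StrictMono piv) {L : List (Fin n)}
    (hL : L.Nodup) {c : Fin n} (hmem : ∀ a, a ∈ L ↔ a < c ∧ ∀ r, piv r ≠ a) :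
    (rowsBefore piv c).length + L.length = c := by
  have hnd : ((rowsBefore piv c).map piv ++ L).Nodup := by
    refine ((nodup_rowsBefore piv c).map hp.injective).append hL ?_
    intro a ha hb
    obtain ⟨r, _, rfl⟩ := List.mem_map.1 ha
    exact ((hmem _).1 hb).2 r rfl
  have hset : ((rowsBefore piv c).map piv ++ L).toFinset = Finset.Iio c := by
    ext a
    simp only [List.mem_toFinset, List.mem_append, List.mem_map, mem_rowsBefore, hmem,
      Finset.mem_Iio]
    constructor
    · rintro (⟨r, hr, rfl⟩ | h)
      · exact hr
      · exact h.1
    · intro h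
      by_cases h' : ∃ r, piv r = a
      · obtain ⟨r, rfl⟩ := h'
        exact .inl ⟨r, h, rfl⟩
      · push Not at h'
        exact .inr ⟨h, h'⟩
  have := List.toFinset_card_of_nodup hnd
  rw [hset, Fin.card_Iio] at this
  simpa using this.symm

/-- The positions of the columns without a leading coefficient, from the column heights. -/
def columnPositions : List ℕ → List ℕ
  | [] => []
  | d :: D => (d + D.length) :: columnPositions D

@[simp] theorem length_columnPositions (D : List ℕ) : (columnPositions D).length = D.length := by
  induction D with
  | nil => rfl
  | cons d D ih => simp [columnPositions, ih]

theorem columnPositions_injective : Function.Injective columnPositions := by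
  intro D D' h
  induction D generalizing D' with
  | nil => cases D' <;> simp_all [columnPositions]
  | cons d D ih =>
    cases D' with
    | nil => simp [columnPositions] at h
    | cons d' D' =>
      simp only [columnPositions, List.cons.injEq] at h
      have := ih h.2
      subst this
      simpa using h.1

/-- The diagram thus determines the free columns: the position of each is its height plus the number
of free columns further left, which are the rest of the list. -/
theorem map_val_freeColumns {piv : Fin k → Fin n} (hp : StrictMono piv) :
    (freeColumns piv).map Fin.val = columnPositions (diagramOf piv) := by
  suffices h : ∀ P L : List (Fin n), P ++ L = freeColumns piv → L.map Fin.val =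
      columnPositions (L.map fun c => (rowsBefore piv c).length) from h [] _ rfl
  intro P L
  induction L generalizing P with
  | nil => intro _; rfl
  | cons c L ih =>
    intro h
    have hL := ih (P ++ [c]) (by simpa using h)
    have hs := pairwise_freeColumns piv
    rw [← h, List.pairwise_append, List.pairwise_cons] at hs
    obtain ⟨-, ⟨hs1, hs2⟩, hs3⟩ := hs
    have := length_rowsBefore_add hp (L := L) (c := c) (hs2.imp fun h => ne_of_gt h) (by
      intro a
      constructor
      · intro ha
        refine ⟨hs1 a ha, ?_⟩
        rw [← mem_freeColumns, ← h]
        simp [ha]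
      · rintro ⟨ha, hf⟩
        rw [← mem_freeColumns, ← h] at hf
        rcases List.mem_append.1 hf with hf | hf
        · exact absurd ha (not_lt_of_gt (hs3 a hf c (by simp)))
        · rcases List.mem_cons.1 hf with rfl | hf
          · exact absurd ha (lt_irrefl _)
          · exact hf)
    simp only [List.map_cons, columnPositions, hL, List.length_map, this]

theorem length_diagramOf {piv : Fin k → Fin n} (hp : StrictMono piv) :
    (diagramOf piv).length = n - k := by
  have h : (freeColumns piv).toFinset = (Finset.univ.image piv)ᶜ := by
    ext a; simp [mem_freeColumns]
  have h2 := List.toFinset_card_of_nodup (nodup_freeColumns piv)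
  rw [h, Finset.card_compl, Finset.card_image_of_injective _ hp.injective] at h2
  simpa [diagramOf] using h2.symm

theorem isDiagram_map_rowsBefore (piv : Fin k → Fin n) (L : List (Fin n))
    (hL : L.Pairwise (· > ·)) (a : ℕ) (ha : ∀ c ∈ L, (rowsBefore piv c).length ≤ a) :
    IsDiagram a (L.map fun c => (rowsBefore piv c).length) := by
  induction L generalizing a with
  | nil => trivial
  | cons c L ih =>
    rw [List.pairwise_cons] at hL
    refine ⟨ha c (by simp), ih hL.2 _ fun c' hc' => ?_⟩
    refine (List.monotone_filter_right _ fun r hr => ?_).length_le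
    simp only [decide_eq_true_eq] at hr ⊢
    exact hr.trans (hL.1 c' hc')

theorem isDiagram_diagramOf (piv : Fin k → Fin n) : IsDiagram k (diagramOf piv) := by
  refine isDiagram_map_rowsBefore piv _ (pairwise_freeColumns piv) k fun c _ => ?_
  exact (List.length_filter_le _ _).trans (by simp)

theorem length_entriesOf {F : Type*} {q : ℕ} (e : F ≃ Fin q) (M : Matrix (Fin k) (Fin n) F)
    (piv : Fin k → Fin n) : (entriesOf e M piv).length = (diagramOf piv).sum := by
  simp [entriesOf, diagramOf, List.length_flatMap]

theorem isForm_of_strictMono {F : Type*} {q : ℕ} (e : F ≃ Fin q) (M : Matrix (Fin k) (Fin n) F)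
    {piv : Fin k → Fin n} (hp : StrictMono piv) :
    IsForm q k (n - k) (diagramOf piv) (entriesOf e M piv) where
  length_diagram := length_diagramOf hp
  isDiagram := isDiagram_diagramOf piv
  length_entries := length_entriesOf e M piv
  isDigits := by
    intro d hd
    simp only [entriesOf, List.mem_flatMap, List.mem_map] at hd
    obtain ⟨c, _, r, _, rfl⟩ := hd
    exact Fin.is_lt _

theorem eq_of_freeColumns_eq {piv piv' : Fin k → Fin n} (hp : StrictMono piv)
    (hp' : StrictMono piv') (h : freeColumns piv = freeColumns piv') : piv = piv' := by
  refine (StrictMono.range_inj hp hp').1 (Set.ext fun c => ?_)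
  have h1 := mem_freeColumns (piv := piv) (c := c)
  rw [h, mem_freeColumns] at h1
  constructor <;> rintro ⟨r, hr⟩ <;> by_contra hc
  · exact h1.1 (fun s hs => hc ⟨s, hs⟩) r hr
  · exact h1.2 (fun s hs => hc ⟨s, hs⟩) r hr

theorem pairwise_columnPositions {a : ℕ} {D : List ℕ} (h : IsDiagram a D) :
    (columnPositions D).Pairwise (· > ·) ∧ ∀ c ∈ columnPositions D, c < a + D.length := by
  induction D generalizing a with
  | nil => simp [columnPositions]
  | cons d D ih =>
    obtain ⟨h1, h2⟩ := ih h.2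
    have := h.1
    refine ⟨List.pairwise_cons.2 ⟨h2, h1⟩, ?_⟩
    intro c hc
    rw [List.length_cons]
    rcases List.mem_cons.1 hc with rfl | hc
    · omega
    · have := h2 c hc; omega

/-- The pivots enumerate the complement of `columnPositions D` in increasing order; injectivity of
`columnPositions` then identifies the diagram. -/
theorem exists_diagramOf_eq (hk : k ≤ n) {D : List ℕ} (hD : IsDiagram k D)
    (hl : D.length = n - k) : ∃ piv : Fin k → Fin n, StrictMono piv ∧ diagramOf piv = D := by
  obtain ⟨h1, h2⟩ := pairwise_columnPositions hD
  have h3 : ∀ l : List ℕ, (∀ a ∈ l, a < n) → ∃ L : List (Fin n), L.map Fin.val = l := by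
    intro l hl
    induction l with
    | nil => exact ⟨[], rfl⟩
    | cons a l ih =>
      obtain ⟨L, rfl⟩ := ih fun b hb => hl b (by simp [hb])
      exact ⟨⟨a, hl a (by simp)⟩ :: L, rfl⟩
  obtain ⟨L, hL⟩ := h3 (columnPositions D) fun c hc => by have := h2 c hc; omega
  have hLs : L.Pairwise (· > ·) := by
    rw [← hL, List.pairwise_map] at h1
    exact h1
  have hLl : L.length = n - k := by
    have := congrArg List.length hL
    simpa [hl] using this
  have hcard : (L.toFinsetᶜ).card = k := by
    rw [Finset.card_compl, List.toFinset_card_of_nodup (hLs.imp fun h => ne_of_gt h), hLl,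
      Fintype.card_fin]
    omega
  let piv : Fin k → Fin n := (L.toFinsetᶜ).orderEmbOfFin hcard
  have hp : StrictMono piv := ((L.toFinsetᶜ).orderEmbOfFin hcard).strictMono
  refine ⟨piv, hp, columnPositions_injective ?_⟩
  rw [← map_val_freeColumns hp, ← hL]
  congr 1
  refine List.Pairwise.eq_of_mem_iff (r := (· > ·)) (pairwise_freeColumns piv) hLs fun c => ?_
  have hr : Set.range piv = (L.toFinsetᶜ : Finset (Fin n)) := Finset.range_orderEmbOfFin _ hcard
  have : c ∈ Set.range piv ↔ c ∉ L := by rw [hr]; simp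
  rw [mem_freeColumns]
  constructor
  · intro h
    by_contra hc
    obtain ⟨r, hr⟩ := this.2 hc
    exact h r hr
  · intro h r hr
    exact this.1 ⟨r, hr⟩ h

end Columns

/-- Any vector of the right length can be filled into the dots: it is cut into consecutive blocks,
one per column. Absence of duplicates makes the prescribed values consistent. -/
theorem List.exists_flatMap_map_eq {α β γ : Type*} [Inhabited γ] [DecidableEq α] [DecidableEq β]
    (L : List α) (hL : L.Nodup) (g : α → List β) (hg : ∀ a, (g a).Nodup) (x : List γ)
    (hx : x.length = (L.map fun a => (g a).length).sum) :
    ∃ f : α → β → γ, L.flatMap (fun a => (g a).map (f a)) = x := by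
  induction L generalizing x with
  | nil => exact ⟨fun _ _ => default, (List.eq_nil_of_length_eq_zero (by simpa using hx)).symm⟩
  | cons a L ih =>
    rw [List.nodup_cons] at hL
    rw [List.map_cons, List.sum_cons] at hx
    obtain ⟨f, hf⟩ := ih hL.2 (x.drop (g a).length) (by rw [List.length_drop]; omega)
    refine ⟨Function.update f a fun b => (x[(g a).idxOf b]?).getD default, ?_⟩
    rw [List.flatMap_cons]
    have h1 : L.flatMap (fun c => (g c).map
        (Function.update f a (fun b => (x[(g a).idxOf b]?).getD default) c)) =
        x.drop (g a).length := by
      rw [← hf]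
      refine List.flatMap_congr fun c hc => ?_
      rw [Function.update_of_ne]
      rintro rfl
      exact hL.1 hc
    have h2 : (g a).map (Function.update f a (fun b => (x[(g a).idxOf b]?).getD default) a) =
        x.take (g a).length := by
      rw [Function.update_self]
      refine List.ext_getElem (by simp; omega) fun i hi hi' => ?_
      have hi2 : i < x.length := by
        rw [List.length_map] at hi; omega
      rw [List.getElem_map, List.getElem_take, (hg a).idxOf_getElem i, List.getElem?_eq_getElem hi2]
      rfl
    rw [h1, h2, List.take_append_drop]

theorem List.flatMap_map_inj {α β γ : Type*} {L : List α} {g : α → List β} {f f' : α → β → γ}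
    (h : L.flatMap (fun a => (g a).map (f a)) = L.flatMap (fun a => (g a).map (f' a)))
    {a : α} (ha : a ∈ L) {b : β} (hb : b ∈ g a) : f a b = f' a b := by
  induction L with
  | nil => simp at ha
  | cons c L ih =>
    rw [List.flatMap_cons, List.flatMap_cons] at h
    obtain ⟨h1, h2⟩ := List.append_inj h (by simp)
    rcases List.mem_cons.1 ha with rfl | ha
    · exact List.map_inj_left.1 h1 b hb
    · exact ih h2 ha

/-! ### Subspaces, echelon matrices and tableaux forms -/

section Matrices

variable {F : Type*} [Field F] {q n k : ℕ}

/-- The diagram fixes the pivots, hence the pivot columns and the zeros left of the pivots; all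
remaining entries are listed in the entries vector. -/
theorem IsRREF.eq_of_form_eq {e : F ≃ Fin q} {M M' : Matrix (Fin k) (Fin n) F}
    {piv piv' : Fin k → Fin n} (h : IsRREF M piv) (h' : IsRREF M' piv')
    (hD : diagramOf piv = diagramOf piv') (hx : entriesOf e M piv = entriesOf e M' piv') :
    M = M' := by
  have hf : freeColumns piv = freeColumns piv' := by
    have h1 := map_val_freeColumns h.pivot_strictMono
    rw [hD, ← map_val_freeColumns h'.pivot_strictMono] at h1
    exact List.map_injective_iff.2 Fin.val_injective h1
  obtain rfl := eq_of_freeColumns_eq h.pivot_strictMono h'.pivot_strictMono hf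
  ext r c
  by_cases hc : c ∈ freeColumns piv
  · rcases lt_trichotomy c (piv r) with hlt | rfl | hlt
    · rw [h.zero_left r c hlt, h'.zero_left r c hlt]
    · exact absurd rfl (mem_freeColumns.1 hc r)
    · have := List.flatMap_map_inj hx hc (mem_rowsBefore.2 hlt)
      exact e.injective (Fin.val_injective this)
  · rw [mem_freeColumns] at hc
    push Not at hc
    obtain ⟨s, rfl⟩ := hc
    by_cases hs : r = s
    · subst hs; rw [h.pivot_one, h'.pivot_one]
    · rw [h.pivot_column s r hs, h'.pivot_column s r hs]

theorem exists_isRREF (e : F ≃ Fin q) (hk : k ≤ n) {D x : List ℕ}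
    (hDx : IsForm q k (n - k) D x) : ∃ (M : Matrix (Fin k) (Fin n) F) (piv : Fin k → Fin n),
      IsRREF M piv ∧ D = diagramOf piv ∧ x = entriesOf e M piv := by
  obtain ⟨piv, hp, hD⟩ := exists_diagramOf_eq hk hDx.isDiagram hDx.length_diagram
  obtain ⟨f, hf⟩ := List.exists_flatMap_map_eq (freeColumns piv) (nodup_freeColumns piv)
    (rowsBefore piv) (nodup_rowsBefore piv) x (by rw [hDx.length_entries, ← hD]; rfl)
  have hq : 0 < q := (Nat.zero_le _).trans_lt (e 0).is_lt
  let M : Matrix (Fin k) (Fin n) F := fun r c =>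
    if c = piv r then 1 else
      -- The reduction mod `q` only makes the expression total; on the dots `f c r` is already a
      -- digit.
      if c ∈ freeColumns piv ∧ piv r < c then e.symm ⟨f c r % q, Nat.mod_lt _ hq⟩ else 0
  refine ⟨M, piv, ⟨hp, ?_, ?_, ?_⟩, hD.symm, ?_⟩
  · intro r c hc
    simp [M, hc.ne, not_lt_of_gt hc]
  · intro r
    simp [M]
  · intro r s hs
    have h1 : piv r ≠ piv s := fun h => hs (hp.injective h).symm
    have h2 : piv r ∉ freeColumns piv := fun h => mem_freeColumns.1 h r rfl
    simp [M, h1, h2]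
  · rw [← hf, entriesOf]
    refine List.flatMap_congr fun c hc => List.map_inj_left.2 fun r hr => ?_
    have h1 : c ≠ piv r := fun h => mem_freeColumns.1 hc r h.symm
    have h2 : f c r < q := hDx.isDigits _ (by
      rw [← hf]
      exact List.mem_flatMap.2 ⟨c, hc, List.mem_map_of_mem hr⟩)
    simp [M, h1, hc, mem_rowsBefore.1 hr, Nat.mod_eq_of_lt h2]

/-- The pivot columns form an identity matrix, so the coefficients of a combination of the rows can
be read off there. -/
theorem IsRREF.eq_sum_of_mem_span {M : Matrix (Fin k) (Fin n) F} {piv : Fin k → Fin n}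
    (h : IsRREF M piv) {v : Fin n → F} (hv : v ∈ Submodule.span F (Set.range M.row)) :
    v = ∑ r, v (piv r) • M.row r := by
  obtain ⟨a, rfl⟩ := (Submodule.mem_span_range_iff_exists_fun F).1 hv
  refine Finset.sum_congr rfl fun r _ => ?_
  congr 1
  rw [Finset.sum_apply, Finset.sum_eq_single r]
  · simp [Matrix.row, h.pivot_one]
  · intro s _ hs
    simp [Matrix.row, h.pivot_column r s hs]
  · simp

theorem IsRREF.exists_leading {M : Matrix (Fin k) (Fin n) F} {piv : Fin k → Fin n}
    (h : IsRREF M piv) {v : Fin n → F} (hv : v ∈ Submodule.span F (Set.range M.row))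
    (hv0 : v ≠ 0) : ∃ r, v (piv r) ≠ 0 ∧ ∀ c < piv r, v c = 0 := by
  have hs := h.eq_sum_of_mem_span hv
  have hne : ∃ r, v (piv r) ≠ 0 := by
    by_contra hc
    push Not at hc
    apply hv0
    rw [hs]
    exact Finset.sum_eq_zero fun r _ => by rw [hc r, zero_smul]
  have hmin := WellFounded.min_mem (wellFounded_lt (α := Fin k)) {r | v (piv r) ≠ 0} hne
  set r := WellFounded.min (wellFounded_lt (α := Fin k)) {r | v (piv r) ≠ 0} hne
  refine ⟨r, hmin, fun c hc => ?_⟩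
  rw [hs, Finset.sum_apply]
  refine Finset.sum_eq_zero fun s _ => ?_
  rw [Pi.smul_apply, smul_eq_mul]
  rcases lt_or_ge s r with hsr | hsr
  · have : v (piv s) = 0 := by
      by_contra hne'
      exact WellFounded.not_lt_min (wellFounded_lt (α := Fin k)) {r | v (piv r) ≠ 0} hne' hsr
    rw [this, zero_mul]
  · have : M s c = 0 := h.zero_left s c (hc.trans_le (h.pivot_strictMono.monotone hsr))
    rw [Matrix.row, this, mul_zero]

theorem IsRREF.row_mem_span (M : Matrix (Fin k) (Fin n) F) (r : Fin k) :
    M.row r ∈ Submodule.span F (Set.range M.row) :=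
  Submodule.subset_span ⟨r, rfl⟩

/-- A nonzero vector of the span has its leading coefficient in a pivot column. Applied to the rows
of `M` inside the span of `M'`, this places the pivots of `M` among those of `M'`. -/
theorem IsRREF.range_pivot_subset {M M' : Matrix (Fin k) (Fin n) F} {piv piv' : Fin k → Fin n}
    (h : IsRREF M piv) (h' : IsRREF M' piv')
    (hs : Submodule.span F (Set.range M.row) = Submodule.span F (Set.range M'.row)) :
    Set.range piv ⊆ Set.range piv' := by
  rintro _ ⟨r, rfl⟩
  have h1 : M.row r (piv r) = 1 := h.pivot_one r
  obtain ⟨r', h2, h3⟩ := h'.exists_leading (hs ▸ IsRREF.row_mem_span M r) (v := M.row r)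
    (fun h0 => one_ne_zero (h1.symm.trans (congrFun h0 (piv r))))
  refine ⟨r', ?_⟩
  rcases lt_trichotomy (piv r) (piv' r') with hlt | heq | hlt
  · exact absurd (h1.symm.trans (h3 _ hlt)) one_ne_zero
  · exact heq.symm
  · exact absurd (h.zero_left r _ hlt) h2

theorem IsRREF.eq_of_span_eq {M M' : Matrix (Fin k) (Fin n) F} {piv piv' : Fin k → Fin n}
    (h : IsRREF M piv) (h' : IsRREF M' piv')
    (hs : Submodule.span F (Set.range M.row) = Submodule.span F (Set.range M'.row)) :
    M = M' ∧ piv = piv' := by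
  obtain rfl : piv = piv' := (StrictMono.range_inj h.pivot_strictMono h'.pivot_strictMono).1
    ((h.range_pivot_subset h' hs).antisymm (h'.range_pivot_subset h hs.symm))
  refine ⟨?_, rfl⟩
  suffices hr : ∀ r, M.row r = M'.row r from Matrix.ext fun r c => congrFun (hr r) c
  intro r
  rw [h'.eq_sum_of_mem_span (v := M.row r) (hs ▸ IsRREF.row_mem_span M r), Finset.sum_eq_single r]
  · simp [Matrix.row, h.pivot_one]
  · intro s _ hsr
    simp [Matrix.row, h.pivot_column s r hsr.symm]
  · simp

theorem IsRREF.finrank_span {M : Matrix (Fin k) (Fin n) F} {piv : Fin k → Fin n}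
    (h : IsRREF M piv) : Module.finrank F (Submodule.span F (Set.range M.row)) = k := by
  have hli : LinearIndependent F M.row := by
    rw [Fintype.linearIndependent_iff]
    intro a ha r
    have := congrFun ha (piv r)
    rw [Finset.sum_apply, Finset.sum_eq_single r] at this
    · simpa [Matrix.row, h.pivot_one] using this
    · intro s _ hs
      simp [Matrix.row, h.pivot_column r s hs]
    · simp
  rw [finrank_span_eq_card hli, Fintype.card_fin]

theorem HasTableauxForm.isForm {e : F ≃ Fin q} {X : Grass F n k} {D x : List ℕ}
    (h : HasTableauxForm e X D x) : IsForm q k (n - k) D x := by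
  obtain ⟨M, piv, h, -, rfl, rfl⟩ := h
  exact isForm_of_strictMono e M h.pivot_strictMono

theorem HasTableauxForm.form_unique {e : F ≃ Fin q} {X : Grass F n k} {D x D' x' : List ℕ}
    (h : HasTableauxForm e X D x) (h' : HasTableauxForm e X D' x') : D = D' ∧ x = x' := by
  obtain ⟨M, piv, h, hs, rfl, rfl⟩ := h
  obtain ⟨M', piv', h', hs', rfl, rfl⟩ := h'
  obtain ⟨rfl, rfl⟩ := h.eq_of_span_eq h' (hs.trans hs'.symm)
  exact ⟨rfl, rfl⟩

theorem HasTableauxForm.subspace_unique {e : F ≃ Fin q} {X Y : Grass F n k} {D x : List ℕ}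
    (h : HasTableauxForm e X D x) (h' : HasTableauxForm e Y D x) : X = Y := by
  obtain ⟨M, piv, h, hs, hD, hx⟩ := h
  obtain ⟨M', piv', h', hs', hD', hx'⟩ := h'
  obtain rfl := h.eq_of_form_eq h' (hD.symm.trans hD') (hx.symm.trans hx')
  exact Subtype.ext (hs.symm.trans hs')

theorem IsForm.exists_hasTableauxForm (e : F ≃ Fin q) (hk : k ≤ n) {D x : List ℕ}
    (h : IsForm q k (n - k) D x) : ∃ X : Grass F n k, HasTableauxForm e X D x := by
  obtain ⟨M, piv, hM, hD, hx⟩ := exists_isRREF e hk h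
  exact ⟨⟨_, hM.finrank_span⟩, M, piv, hM, rfl, hD, hx⟩

/-- If every rank below `G` is attained, the index of a subspace is the rank of its tableaux
form. -/
theorem indF_eq_formRank (hq : 2 ≤ q) (e : F ≃ Fin q) (hk : k ≤ n) {X : Grass F n k}
    {D x : List ℕ} (hX : HasTableauxForm e X D x)
    (hsurj : ∀ j < formRank q k (n - k) D x, ∃ D' x', IsForm q k (n - k) D' x' ∧
      formRank q k (n - k) D' x' = j) :
    indF e X = formRank q k (n - k) D x := by
  have hex : ∀ j : Fin (formRank q k (n - k) D x), ∃ Y : Grass F n k, ∃ D' x',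
      HasTableauxForm e Y D' x' ∧ formRank q k (n - k) D' x' = j := by
    intro j
    obtain ⟨D', x', h, hj⟩ := hsurj j j.2
    obtain ⟨Y, hY⟩ := h.exists_hasTableauxForm e hk
    exact ⟨Y, D', x', hY, hj⟩
  choose Y D' x' hY hj using hex
  have hlt : ∀ j, GrassLT e (Y j) X := fun j =>
    ⟨_, _, _, _, hY j, hX, ((hY j).isForm.tableauxLT_iff hq hX.isForm).2 (by
      rw [hj]; exact j.2)⟩
  -- Injective because the rank recovers `j`; surjective because a predecessor has smaller rank and
  -- rank determines form, hence subspace.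
  have hbij : Function.Bijective fun j => (⟨Y j, hlt j⟩ : {Z : Grass F n k // GrassLT e Z X}) := by
    constructor
    · intro i j hij
      have hij : Y i = Y j := congrArg Subtype.val hij
      obtain ⟨h1, h2⟩ := (hij ▸ hY i).form_unique (hY j)
      refine Fin.ext ?_
      rw [← hj i, ← hj j, h1, h2]
    · rintro ⟨Z, D₁, x₁, D₂, x₂, h1, h2, h3⟩
      obtain ⟨rfl, rfl⟩ := h2.form_unique hX
      rw [h1.isForm.tableauxLT_iff hq h2.isForm] at h3
      refine ⟨⟨_, h3⟩, Subtype.ext ?_⟩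
      have h4 := hY ⟨_, h3⟩
      obtain ⟨h5, h6⟩ := h4.isForm.formRank_injective hq h1.isForm (hj ⟨_, h3⟩)
      rw [h5, h6] at h4
      exact h4.subspace_unique h1
  rw [indF, ← Nat.card_congr (Equiv.ofBijective _ hbij), Nat.card_fin]

end Matrices

namespace Counted

/-! ### The table of partition numbers -/

/-- A loop-invariant rule; `4 * L + 2` pays for incrementing and testing the counter. -/
theorem forLoop_spec {σ : Type} (q : ℕ) (body : ℕ → σ → Counted σ) (I : ℕ → σ → Prop) (B L : ℕ)
    (count start : ℕ) (s : σ) (hI : I start s)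
    (hbody : ∀ j s, start ≤ j → j < start + count → I j s →
      I (j + 1) (body j s).val ∧ (body j s).cost ≤ B)
    (hL : ∀ a ≤ start + count, idxLen q a ≤ L) :
    I (start + count) (forLoop q body count start s).val ∧
      (forLoop q body count start s).cost ≤ count * (B + 4 * L + 2) := by
  induction count generalizing start s with
  | zero => simpa [forLoop] using hI
  | succ c ih =>
    obtain ⟨h1, h2⟩ := hbody start s le_rfl (by omega) hI
    obtain ⟨h3, h4⟩ := ih (start + 1) _ h1
      (fun j s hj hj' => hbody j s (by omega) (by omega)) (fun a ha => hL a (by omega))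
    have e1 := hL start (by omega)
    have e2 := hL 1 (by omega)
    have e3 := hL (start + 1) (by omega)
    have e4 := hL (start + c + 1) (by omega)
    simp only [forLoop, val_bind, cost_bind, idxAdd, idxEq]
    refine ⟨by rwa [← add_assoc, add_right_comm], ?_⟩
    rw [add_mul, one_mul]
    omega

/-- The cells of the table that precede `(j, l, i)` hold the right numbers. -/
def Filled (q η N : ℕ) (T : Table) (j l i : ℕ) : Prop :=
  ∀ a b c, b ≤ η → c ≤ N → (a < j ∨ a = j ∧ (b < l ∨ b = l ∧ c < i)) →
    T (a, b, c) = Nat.digits q (boxCount a b c)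

/-- Both cells of the recurrence precede `(j, l, i)` in the filling order. The `5 * W` comes from
two reads, an addition charged for both operands, and a write. -/
theorem fillCell_spec {q η N : ℕ} (hq : 2 ≤ q) {T : Table} {j l i L W : ℕ}
    (hT : Filled q η N T j l i) (hl : l ≤ η) (hi : i ≤ N)
    (hL : ∀ a, a ≤ j ∨ a ≤ l ∨ a ≤ i → idxLen q a ≤ L)
    (hW : ∀ a b c, c ≤ N → (Nat.digits q (boxCount a b c)).length ≤ W) :
    Filled q η N (fillCell q j l i T).val j l (i + 1) ∧
      (fillCell q j l i T).cost ≤ 20 * L + 5 * W + 12 := by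
  suffices h : (fillCell q j l i T).val =
      Function.update T (j, l, i) (Nat.digits q (boxCount j l i)) ∧
      (fillCell q j l i T).cost ≤ 20 * L + 5 * W + 12 by
    refine ⟨?_, h.2⟩
    intro a b c hb hc habc
    rw [h.1]
    by_cases he : (a, b, c) = (j, l, i)
    · rw [he, Function.update_self]
      simp only [Prod.mk.injEq] at he
      rw [he.1, he.2.1, he.2.2]
    · rw [Function.update_of_ne he]
      simp only [Prod.mk.injEq] at he
      exact hT a b c hb hc (by omega)
  have one : Nat.digits q 1 = [1] := Nat.digits_of_lt q 1 (by omega) (by omega)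
  have len1 : idxLen q 1 = 1 := by simp [idxLen, one]
  have len0 : idxLen q 0 = 0 := by simp [idxLen]
  have e1 := hL j (by omega)
  have e2 := hL l (by omega)
  have e3 := hL i (by omega)
  have w0 := hW 0 0 0 (by omega)
  rw [boxCount_zero, one, List.length_singleton] at w0
  unfold fillCell
  rcases Nat.eq_zero_or_pos i with rfl | hi0
  · simp only [val_bind, cost_bind, idxEq, decide_true, if_true, writeCell, boxCount_zero, one,
      addrCost, List.length_singleton, len0]
    exact ⟨trivial, by omega⟩
  rcases Nat.eq_zero_or_pos j with rfl | hj0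
  · simp [idxEq, writeCell, boxCount_zero_left, hi0.ne', addrCost, len0]
    omega
  rcases Nat.eq_zero_or_pos l with rfl | hl0
  · simp [idxEq, writeCell, boxCount_zero_right, hi0.ne', hj0.ne', addrCost, len0]
    omega
  obtain ⟨j, rfl⟩ : ∃ j', j = j' + 1 := ⟨j - 1, by omega⟩
  obtain ⟨l, rfl⟩ : ∃ l', l = l' + 1 := ⟨l - 1, by omega⟩
  have l1 : 1 ≤ L := len1 ▸ hL 1 (by omega)
  have e4 := hL l (by omega)
  have e5 := hL (i - (j + 1)) (by omega)
  have e6 := hL j (by omega)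
  have t1 : T (j, l + 1, i) = Nat.digits q (boxCount j (l + 1) i) :=
    hT _ _ _ hl hi (by omega)
  have w1 := hW j (l + 1) i hi
  by_cases hij : i < j + 1
  · have h : boxCount (j + 1) (l + 1) i = boxCount j (l + 1) i := by
      rw [boxCount_succ, if_neg (by omega), zero_add]
    simp [idxEq, idxSub, idxLt, readCell, writeCell, hi0.ne', hij, addrCost, h, t1, len1, len0]
    omega
  · have t2 : T (j + 1, l, i - (j + 1)) = Nat.digits q (boxCount (j + 1) l (i - (j + 1))) :=
      hT _ _ _ (by omega) (by omega) (by omega)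
    have w2 := hW (j + 1) l (i - (j + 1)) (by omega)
    have w3 := hW (j + 1) (l + 1) i hi
    have h := boxCount_succ j l i
    rw [if_pos (by omega)] at h
    have hadd := qAddCarry_digits_val hq (boxCount (j + 1) l (i - (j + 1)))
      (boxCount j (l + 1) i) 0 (by omega)
    rw [add_zero, ← h] at hadd
    have hcost := qAddCarry_cost_le q (Nat.digits q (boxCount (j + 1) l (i - (j + 1))))
      (Nat.digits q (boxCount j (l + 1) i)) 0
    simp [idxEq, idxSub, idxLt, readCell, writeCell, hi0.ne', hij, addrCost, t1, t2, qAdd, hadd,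
      len1, len0]
    omega

/-- The table is right within its range. -/
def IsTable (q k η N : ℕ) (T : Table) : Prop :=
  ∀ a b c, a ≤ k → b ≤ η → c ≤ N → T (a, b, c) = Nat.digits q (boxCount a b c)

/-- Three nested uses of `forLoop_spec`. Only cells with `c ≤ N` and `b ≤ η` matter, so the
invariant at the end of a row or layer is the one at the start of the next. -/
theorem buildTable_spec {q k η N L W : ℕ} (hq : 2 ≤ q)
    (hL : ∀ a, a ≤ k + 1 ∨ a ≤ η + 1 ∨ a ≤ N + 1 → idxLen q a ≤ L)
    (hW : ∀ a b c, c ≤ N → (Nat.digits q (boxCount a b c)).length ≤ W) :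
    IsTable q k η N (buildTable q k η N).val ∧ (buildTable q k η N).cost ≤
      (k + 1) * ((η + 1) * ((N + 1) * (24 * L + 5 * W + 14) + 4 * L + 2) + 4 * L + 2) := by
  have hrow : ∀ j l T, j ≤ k → l ≤ η → Filled q η N T j l 0 →
      Filled q η N (forLoop q (fun i => fillCell q j l i) (N + 1) 0 T).val j (l + 1) 0 ∧
      (forLoop q (fun i => fillCell q j l i) (N + 1) 0 T).cost ≤
        (N + 1) * (24 * L + 5 * W + 14) := by
    intro j l T hj hl hT
    obtain ⟨h1, h2⟩ := forLoop_spec q (fun i => fillCell q j l i)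
      (fun i T => Filled q η N T j l i) (20 * L + 5 * W + 12) L (N + 1) 0 T hT
      (fun i T _ hi hT => fillCell_spec hq hT hl (by omega) (fun a ha => hL a (by omega)) hW)
      (fun a ha => hL a (by omega))
    refine ⟨fun a b c hb hc habc => h1 a b c hb hc (by omega), h2.trans (le_of_eq ?_)⟩
    congr 1; ring
  have hlayer : ∀ j T, j ≤ k → Filled q η N T j 0 0 →
      Filled q η N (forLoop q (fun l => forLoop q (fun i => fillCell q j l i) (N + 1) 0)
        (η + 1) 0 T).val (j + 1) 0 0 ∧
      (forLoop q (fun l => forLoop q (fun i => fillCell q j l i) (N + 1) 0)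
        (η + 1) 0 T).cost ≤ (η + 1) * ((N + 1) * (24 * L + 5 * W + 14) + 4 * L + 2) := by
    intro j T hj hT
    obtain ⟨h1, h2⟩ := forLoop_spec q
      (fun l => forLoop q (fun i => fillCell q j l i) (N + 1) 0)
      (fun l T => Filled q η N T j l 0) _ L (η + 1) 0 T hT
      (fun l T _ hl hT => hrow j l T hj (by omega) hT) (fun a ha => hL a (by omega))
    exact ⟨fun a b c hb hc habc => h1 a b c hb hc (by omega), h2⟩
  obtain ⟨h1, h2⟩ := forLoop_spec q
    (fun j => forLoop q (fun l => forLoop q (fun i => fillCell q j l i) (N + 1) 0) (η + 1) 0)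
    (fun j T => Filled q η N T j 0 0) _ L (k + 1) 0 (fun _ => [])
    (fun a b c _ _ h => by omega)
    (fun j T _ hj hT => hlayer j T (by omega) hT) (fun a ha => hL a (by omega))
  exact ⟨fun a b c ha hb hc => h1 a b c hb hc (by omega), h2⟩

/-! ### From an index to a Ferrers diagram -/

section Search

variable {q k η N W : ℕ} {T : Table}

/-- From here on index lengths are bounded by the indices themselves: the search can afford `O(N)`
per test. -/
theorem lookupN_spec (hq : 2 ≤ q) (hT : IsTable q k η N T)
    (hW : ∀ a b c, c ≤ N → (Nat.digits q (boxCount a b c)).length ≤ W) {m j S a : ℕ}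
    (ha : a ≤ k) (hS : S ≤ m) (hm : m ≤ N) (hj : j ≤ η) :
    (lookupN q η T m j S a).val = Nat.digits q (colCount (η - j) (m - S) a) ∧
      (Nat.digits q (colCount (η - j) (m - S) a)).length ≤ W ∧
      (lookupN q η T m j S a).cost ≤ 6 * (N + k + η + 1) + W := by
  have l1 := idxLen_le_self hq S
  have l2 := idxLen_le_self hq a
  have l3 := idxLen_le_self hq m
  have l4 := idxLen_le_self hq (S + a)
  have l5 := idxLen_le_self hq η
  have l6 := idxLen_le_self hq j
  have l7 := idxLen_le_self hq (η - j)
  have l8 := idxLen_le_self hq (m - (S + a))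
  unfold lookupN
  by_cases h : m < S + a
  · have h' : ¬a ≤ m - S := by omega
    simp [idxAdd, idxLt, h, colCount, h']
    omega
  · have h' : a ≤ m - S := by omega
    have hs : m - S - a = m - (S + a) := by omega
    have t := hT a (η - j) (m - (S + a)) ha (by omega) (by omega)
    have w := hW a (η - j) (m - (S + a)) (by omega)
    simp [idxAdd, idxLt, idxSub, readCell, addrCost, h, colCount, h', hs, t]
    omega

/-- The invariant `hh` says that `h` indexes a diagram whose next column has height at most `a`. A
failed test removes those of height exactly `a`, and the total removed is the first summand of
`diagRank`. -/
theorem whileB_spec (hq : 2 ≤ q) (hT : IsTable q k η N T)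
    (hW : ∀ a b c, c ≤ N → (Nat.digits q (boxCount a b c)).length ≤ W) {m j S : ℕ}
    (hS : S ≤ m) (hm : m ≤ N) (hj : j ≤ η) (a : ℕ) (ha : a ≤ k) (h : List ℕ)
    (hd : IsDigits q h) (hh : Nat.ofDigits q h < boxCount a (η - j + 1) (m - S)) :
    let w := whileB q η T m j S a h
    w.val.1 ≤ a ∧ S + w.val.1 ≤ m ∧ IsDigits q w.val.2 ∧ w.val.2.length = h.length ∧
      Nat.ofDigits q w.val.2 < boxCount w.val.1 (η - j) (m - (S + w.val.1)) ∧
      ∑ c ∈ Finset.Ioc w.val.1 a, colCount (η - j) (m - S) c + Nat.ofDigits q w.val.2 =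
        Nat.ofDigits q h ∧
      w.cost ≤ (a + 1) * (8 * (N + k + η + 1) + 2 * W + 2 * h.length) := by
  induction a generalizing h with
  | zero =>
    obtain ⟨v1, v2, v3⟩ := lookupN_spec hq hT hW ha hS hm hj
    have c1 := qLess_cost_le h (Nat.digits q (colCount (η - j) (m - S) 0))
    rw [boxCount_zero_eq_colCount] at hh
    simp only [colCount, Nat.zero_le, if_true, Nat.sub_zero] at hh
    simp only [whileB, val_bind, cost_bind, val_pure, cost_pure, v1]
    refine ⟨le_rfl, by omega, hd, trivial, hh, by simp, ?_⟩
    omega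
  | succ a ih =>
    obtain ⟨v1, v2, v3⟩ := lookupN_spec hq hT hW ha hS hm hj
    set V := colCount (η - j) (m - S) (a + 1) with hV
    have c1 := qLess_cost_le h (Nat.digits q V)
    have hlt := qLess_val hd (isDigits_digits hq V)
    rw [Nat.ofDigits_digits] at hlt
    simp only [whileB, val_bind, cost_bind, v1]
    by_cases hc : (qLess h (Nat.digits q V)).val = true
    · have hlt' := hlt.1 hc
      -- A column exceeding the remaining dots has count `0`, and no `h` is below `0`.
      have hle : a + 1 ≤ m - S := by
        by_contra hcon
        rw [hV, colCount, if_neg hcon] at hlt'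
        omega
      simp only [hc, if_true, val_pure, cost_pure]
      refine ⟨le_rfl, by omega, hd, trivial, ?_, by simp, ?_⟩
      · rw [hV, colCount, if_pos hle, Nat.sub_sub] at hlt'
        exact hlt'
      · rw [add_mul]; omega
    · have hge : V ≤ Nat.ofDigits q h := by
        rw [hlt] at hc; omega
      have hlen : (Nat.digits q V).length ≤ h.length := by
        rcases Nat.eq_zero_or_pos V with h0 | h0
        · simp [h0]
        · simpa using length_le_of_ofDigits_le hq hd 0 V h0 (by simpa using hge)
      obtain ⟨s1, s2, s3, s4⟩ := qSub_spec hd (isDigits_digits hq V) hlen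
        (by rwa [Nat.ofDigits_digits])
      rw [Nat.ofDigits_digits] at s1
      rw [boxCount_succ_eq_colCount, ← hV] at hh
      obtain ⟨r1, r2, r3, r4, r5, r6, r7⟩ := ih (by omega) _ s2 (by omega)
      have l1 := idxLen_le_self hq (a + 1)
      have l2 := idxLen_le_self hq 1
      simp only [hc, Bool.false_eq_true, if_false, val_bind, cost_bind, idxSub]
      refine ⟨by omega, r2, r3, r4.trans s3, r5, ?_, ?_⟩
      · rw [Finset.sum_Ioc_succ_top (by omega), ← hV]; omega
      · rw [s3] at r7
        rw [add_mul (a + 1)]; omega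

theorem columnsB_spec (hq : 2 ≤ q) (hT : IsTable q k η N T)
    (hW : ∀ a b c, c ≤ N → (Nat.digits q (boxCount a b c)).length ≤ W) {m : ℕ} (hm : m ≤ N)
    (count j : ℕ) (hj : j + count = η + 1) (a : ℕ) (ha : a ≤ k) (S : ℕ) (hS : S ≤ m)
    (h : List ℕ) (hd : IsDigits q h) (hh : Nat.ofDigits q h < boxCount a count (m - S)) :
    let r := columnsB q η T m count j a S h
    r.val.length = count ∧ IsDiagram a r.val ∧ r.val.sum = m - S ∧
      diagRank a r.val = Nat.ofDigits q h ∧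
      r.cost ≤ count * ((k + 1) * (8 * (N + k + η + 1) + 2 * W + 2 * h.length) +
        7 * (N + k + η + 1)) := by
  induction count generalizing j a S h with
  | zero =>
    rw [boxCount_zero_right] at hh
    -- With no columns left, `hh` forces all dots to have been placed.
    have hmS : m - S = 0 := by
      by_contra hne
      rw [if_neg hne] at hh
      omega
    rw [if_pos hmS] at hh
    simp only [columnsB, val_pure, cost_pure]
    exact ⟨rfl, trivial, by simp [hmS], by simp [diagRank]; omega, by simp⟩
  | succ c ih =>
    have l1 := idxLen_le_self hq j
    have l2 := idxLen_le_self hq 1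
    have l3 := idxLen_le_self hq η
    have l4 := idxLen_le_self hq (j + 1)
    have l5 := idxLen_le_self hq S
    have l6 := idxLen_le_self hq m
    by_cases hSm : S = m
    · subst hSm
      rw [Nat.sub_self, boxCount_zero] at hh
      obtain ⟨r1, r2, r3, r4, r5⟩ := ih (j + 1) (by omega) 0 (by omega) S hS h hd
        (by rwa [Nat.sub_self, boxCount_zero])
      have l7 := idxLen_le_self hq 0
      rw [Nat.sub_self] at r3 ⊢
      simp only [columnsB, val_bind, cost_bind, idxAdd, idxLt, idxEq, decide_true, if_true,
        idxWrite, val_pure, cost_pure]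
      refine ⟨by simp [r1], ⟨by omega, r2⟩, by simp [r3], ?_, ?_⟩
      -- No diagram of size `0` has a positive column, so padding with zero columns leaves the rank
      -- unchanged.
      · have hz : ∑ c' ∈ Finset.Ioc 0 a, colCount c 0 c' = 0 :=
          Finset.sum_eq_zero fun c' hc' => by
            have := (Finset.mem_Ioc.1 hc').1
            rw [colCount, if_neg (by omega)]
        rw [diagRank, r1, r3, hz, r4, zero_add]
      · rw [add_mul, one_mul]; omega
    · have hb : η - j + 1 = c + 1 := by omega
      have hb' : η - j = c := by omega
      obtain ⟨w1, w2, w3, w4, w5, w6, w7⟩ := whileB_spec hq hT hW hS hm (j := j) (by omega) a ha h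
        hd (by rwa [hb])
      set w := whileB q η T m j S a h with hw
      rw [hb'] at w5 w6
      obtain ⟨r1, r2, r3, r4, r5⟩ := ih (j + 1) (by omega) w.val.1 (by omega) (S + w.val.1) w2
        w.val.2 w3 w5
      have l7 := idxLen_le_self hq w.val.1
      simp only [columnsB, val_bind, cost_bind, idxAdd, idxLt, idxEq, hSm, decide_false,
        Bool.false_eq_true, if_false, ← hw, idxWrite, val_pure, cost_pure]
      refine ⟨by simp [r1], ⟨w1, r2⟩, by simp only [List.sum_cons]; omega, ?_, ?_⟩
      · have hM : w.val.1 + (m - (S + w.val.1)) = m - S := by omega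
        rw [diagRank, r1, r3, r4, hM, w6]
      · rw [w4] at r5
        have := Nat.mul_le_mul_right (8 * (N + k + η + 1) + 2 * W + 2 * h.length)
          (show a + 1 ≤ k + 1 by omega)
        rw [add_mul c, one_mul]; omega

theorem algorithmB_spec (hq : 2 ≤ q) (hT : IsTable q k η N T)
    (hW : ∀ a b c, c ≤ N → (Nat.digits q (boxCount a b c)).length ≤ W) {m : ℕ} (hm : m ≤ N)
    (h : List ℕ) (hd : IsDigits q h) (hh : Nat.ofDigits q h < boxCount k η m) :
    let r := algorithmB q k η T m h
    r.val.length = η ∧ IsDiagram k r.val ∧ r.val.sum = m ∧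
      diagRank k r.val = Nat.ofDigits q h ∧
      r.cost ≤ η * ((k + 1) * (8 * (N + k + η + 1) + 2 * W + 2 * h.length) +
        7 * (N + k + η + 1)) := by
  cases η with
  | zero =>
    exact columnsB_spec hq hT hW hm 0 1 (by omega) k le_rfl 0 (by omega) h hd hh
  | succ c =>
    obtain ⟨w1, w2, w3, w4, w5, w6, w7⟩ := whileB_spec hq hT hW (Nat.zero_le m) hm (j := 1)
      (by omega) k le_rfl h hd hh
    set w := whileB q (c + 1) T m 1 0 k h with hw
    rw [Nat.add_sub_cancel] at w5 w6
    rw [zero_add] at w2 w5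
    obtain ⟨r1, r2, r3, r4, r5⟩ := columnsB_spec hq hT hW hm c 2 (by omega) w.val.1 w1 w.val.1 w2
      w.val.2 w3 w5
    have l7 := idxLen_le_self hq w.val.1
    simp only [algorithmB, val_bind, cost_bind, ← hw, idxWrite, val_pure, cost_pure]
    refine ⟨by simp [r1], ⟨w1, r2⟩, by simp only [List.sum_cons]; omega, ?_, ?_⟩
    · have hM : w.val.1 + (m - w.val.1) = m - 0 := by omega
      rw [diagRank, r1, r3, r4, hM, w6]
    · rw [w4] at r5
      rw [add_mul c, one_mul]; omega

/-! ### From an index to a Ferrers tableaux form -/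

theorem isDigits_append {x y : List ℕ} (hx : IsDigits q x) (hy : IsDigits q y) :
    IsDigits q (x ++ y) := by
  intro d hd
  rcases List.mem_append.1 hd with hd | hd
  · exact hx d hd
  · exact hy d hd

theorem isDigits_replicate_zero (hq : 2 ≤ q) (m : ℕ) : IsDigits q (List.replicate m 0) := by
  intro d hd
  rw [List.eq_of_mem_replicate hd]
  omega

theorem ofDigits_qShift (q m : ℕ) (x : List ℕ) :
    Nat.ofDigits q (qShift m x).val = Nat.ofDigits q x * q ^ m := by
  simp [qShift, Nat.ofDigits_append, mul_comm]

theorem ofDigits_qModPow_add (q m : ℕ) (y : List ℕ) :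
    Nat.ofDigits q (qModPow m y).val + Nat.ofDigits q (qDivPow m y).val * q ^ m =
      Nat.ofDigits q y := by
  simp only [qModPow, qDivPow, Nat.ofDigits_append_replicate_zero]
  rcases Nat.le_total m y.length with h | h
  · conv_rhs => rw [← List.take_append_drop m y, Nat.ofDigits_append, List.length_take,
      min_eq_left h, mul_comm]
  · rw [List.take_of_length_le h, List.drop_of_length_le h]
    simp

/-- The current size is `m = count - 1`, and `y` is the rank minus the number of forms with at least
`count` dots; the equation says this without subtraction. Algorithm B runs only once, so its cost
stands outside the factor `count`. -/
theorem searchC_spec (hq : 2 ≤ q) (hN : N = k * η) (hT : IsTable q k η N T)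
    (hW : ∀ a b c, c ≤ N → (Nat.digits q (boxCount a b c)).length ≤ W)
    (count j : ℕ) (hj : j + count = N + 1) (y : List ℕ) (hd : IsDigits q y)
    (hy : Nat.ofDigits q y < smallCount q k η count) :
    (∃ D x, (searchC q k η N T count j y).val = some (D, x) ∧ IsForm q k η D x ∧
      smallCount q k η (N + 1) + Nat.ofDigits q y =
        smallCount q k η count + formRank q k η D x) ∧
    (searchC q k η N T count j y).cost ≤
      count * (8 * (N + k + η + 1) + 3 * W + 2 * y.length) + y.length + 2 * N +
        η * ((k + 1) * (8 * (N + k + η + 1) + 2 * W + 2 * y.length) + 7 * (N + k + η + 1)) := by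
  induction count generalizing j y with
  | zero => simp [smallCount] at hy
  | succ c ih =>
    have hc : N - j = c := by omega
    have t := hT k η c le_rfl le_rfl (by omega)
    have w := hW k η c (by omega)
    have hpos : 0 < boxCount k η c := boxCount_pos k η c (by omega)
    have hA := ofDigits_qShift q c (Nat.digits q (boxCount k η c))
    rw [Nat.ofDigits_digits] at hA
    have hAd : IsDigits q (qShift c (Nat.digits q (boxCount k η c))).val :=
      isDigits_append (isDigits_replicate_zero hq c) (isDigits_digits hq _)
    have hAl : (qShift c (Nat.digits q (boxCount k η c))).val.length =
        c + (Nat.digits q (boxCount k η c)).length := by simp [qShift]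
    have hAc : (qShift c (Nat.digits q (boxCount k η c))).cost =
        c + (Nat.digits q (boxCount k η c)).length := rfl
    set A := qShift c (Nat.digits q (boxCount k η c)) with hAdef
    have hlt := qLess_val hd hAd
    rw [hA] at hlt
    have c1 := qLess_cost_le y A.val
    have l1 := idxLen_le_self hq N
    have l2 := idxLen_le_self hq j
    have l3 := idxLen_le_self hq k
    have l4 := idxLen_le_self hq η
    have l5 := idxLen_le_self hq c
    have l6 := idxLen_le_self hq (j + 1)
    have l7 := idxLen_le_self hq 1
    rw [smallCount_succ] at hy
    simp only [searchC, val_bind, cost_bind, idxSub, readCell, addrCost, hc, t, ← hAdef, hAc]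
    by_cases hless : (qLess y A.val).val = true
    · have hlt' := hlt.1 hless
      have hsplit := ofDigits_qModPow_add q c y
      have hdiv : Nat.ofDigits q (qDivPow c y).val < boxCount k η c := by
        refine Nat.lt_of_mul_lt_mul_right (a := q ^ c) ?_
        omega
      have hdd : IsDigits q (qDivPow c y).val := fun d hd' => hd d (List.mem_of_mem_drop hd')
      obtain ⟨b1, b2, b3, b4, b5⟩ := algorithmB_spec hq hT hW (show c ≤ N by omega) _ hdd hdiv
      -- The padding to exactly `c` digits gives the entries vector one entry per dot.
      have hml : (qModPow c y).val.length = c := by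
        simp [qModPow]; omega
      have hform : IsForm q k η (algorithmB q k η T c (qDivPow c y).val).val
          (qModPow c y).val.reverse := by
        refine ⟨b1, b2, by rw [List.length_reverse, hml, b3], fun d hd' => ?_⟩
        rw [List.mem_reverse] at hd'
        exact isDigits_append (fun d hd' => hd d (List.mem_of_mem_take hd'))
          (isDigits_replicate_zero hq _) d hd'
      simp only [hless, if_true, val_bind, cost_bind, val_pure, cost_pure, qReverse, hml]
      refine ⟨⟨_, _, rfl, hform, ?_⟩, ?_⟩
      · have hmono := smallCount_mono q k η (show c + 1 ≤ N + 1 by omega)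
        rw [formRank, b3, b4, vecValue, List.reverse_reverse, ← hN]
        omega
      · have hdl : (qDivPow c y).val.length ≤ y.length := by simp [qDivPow]
        have hdc : (qDivPow c y).cost = y.length := rfl
        have hmc : (qModPow c y).cost = c := rfl
        have hb : η * ((k + 1) * (8 * (N + k + η + 1) + 2 * W + 2 * (qDivPow c y).val.length) +
            7 * (N + k + η + 1)) ≤
            η * ((k + 1) * (8 * (N + k + η + 1) + 2 * W + 2 * y.length) +
            7 * (N + k + η + 1)) := by gcongr
        rw [add_mul c, one_mul]
        omega
    · have hge : boxCount k η c * q ^ c ≤ Nat.ofDigits q y := by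
        rw [hlt] at hless; omega
      have hlen := length_le_of_ofDigits_le hq hd c _ hpos hge
      obtain ⟨s1, s2, s3, s4⟩ := qSub_spec hd hAd (by omega) (by omega)
      obtain ⟨⟨D, x, r1, r2, r3⟩, r4⟩ := ih (j + 1) (by omega) _ s2 (by omega)
      simp only [hless, Bool.false_eq_true, if_false, val_bind, cost_bind, idxAdd, idxLt]
      refine ⟨⟨D, x, r1, r2, ?_⟩, ?_⟩
      · rw [smallCount_succ q k η c]; omega
      · rw [s3] at r4
        rw [add_mul c, one_mul]; omega

end Search

/-- Encoding Algorithm C: its result and a bound on its cost in terms of bounds `L` for the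
lengths of loop counters and `W` for the lengths of partition numbers. -/
theorem algorithmC_spec {q n k i L W : ℕ} (hq : 2 ≤ q)
    (hL : ∀ a, a ≤ k + 1 ∨ a ≤ (n - k) + 1 ∨ a ≤ k * (n - k) + 1 → idxLen q a ≤ L)
    (hW : ∀ a b c, c ≤ k * (n - k) → (Nat.digits q (boxCount a b c)).length ≤ W)
    (hi : i < smallCount q k (n - k) (k * (n - k) + 1)) :
    (∃ D x, (algorithmC q n k (Nat.digits q i)).val = some (D, x) ∧ IsForm q k (n - k) D x ∧
      formRank q k (n - k) D x = i) ∧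
    (algorithmC q n k (Nat.digits q i)).cost ≤ idxLen q n + idxLen q k + 1 +
      2 * (idxLen q k + 1) * (idxLen q (n - k) + 1) +
      (k + 1) * (((n - k) + 1) * ((k * (n - k) + 1) * (24 * L + 5 * W + 14) + 4 * L + 2) +
        4 * L + 2) +
      ((k * (n - k) + 1) * (8 * (k * (n - k) + k + (n - k) + 1) + 3 * W +
        2 * (Nat.digits q i).length) + (Nat.digits q i).length + 2 * (k * (n - k)) +
        (n - k) * ((k + 1) * (8 * (k * (n - k) + k + (n - k) + 1) + 2 * W +
          2 * (Nat.digits q i).length) + 7 * (k * (n - k) + k + (n - k) + 1))) := by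
  obtain ⟨hT, hTc⟩ := buildTable_spec hq hL hW
  obtain ⟨⟨D, x, h1, h2, h3⟩, h4⟩ := searchC_spec hq rfl hT hW (k * (n - k) + 1) 0 (by omega)
    (Nat.digits q i) (isDigits_digits hq i) (by rwa [Nat.ofDigits_digits])
  rw [Nat.ofDigits_digits] at h3
  simp only [algorithmC, val_bind, cost_bind, idxSub, idxMul]
  exact ⟨⟨D, x, h1, h2, by omega⟩, by omega⟩

end Counted

/-! ### Explicit cost bound and the main theorem -/

theorem smallCount_eq_eval (q k η : ℕ) :
    smallCount q k η (k * η + 1) = (boxPoly k η).eval q :=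
  sum_boxCount_mul_pow k η q

namespace Counted

theorem length_digits_boxCount_le {q : ℕ} (hq : 2 ≤ q) {s : ℕ} (hs : 0 < s) (a b m : ℕ)
    (hm : m ≤ s * s) : (Nat.digits q (boxCount a b m)).length ≤ 8 * s + 5 :=
  length_digits_le hq ((boxCount_le_two_pow s hs a b m hm).trans_lt
    (Nat.pow_lt_pow_right (by norm_num) (by omega)))

theorem algorithmC_result {q n k i : ℕ} (hq : 2 ≤ q)
    (hi : i < smallCount q k (n - k) (k * (n - k) + 1)) :
    ∃ D x, (algorithmC q n k (Nat.digits q i)).val = some (D, x) ∧ IsForm q k (n - k) D x ∧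
      formRank q k (n - k) D x = i := by
  -- For the result alone any valid `L` and `W` serve, and these also cover `k = 0` and `k = n`.
  refine (algorithmC_spec (L := k + (n - k) + k * (n - k) + 1)
    (W := 8 * (k * (n - k) + 1) + 5) hq (fun a ha => ?_) (fun a b c hc => ?_) hi).1
  · exact (idxLen_le_self hq a).trans (by omega)
  · exact length_digits_boxCount_le hq (Nat.succ_pos _) a b c (by nlinarith)

/-- With `s = ⌊√N⌋ + 1`, indices up to `N + 1 ≤ s ^ 2 < 4 ^ s` have at most `2 s` digits, and
partition numbers at most `8 s + 5`. The constant is `12 + 1076 + 232 + 208 + 5`: initialisation,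
table, main loop, diagram search, and final shifts and output; only the table needs the factor `s`.
-/
theorem algorithmC_cost_le {q n k i : ℕ} (hq : 2 ≤ q) (hk : 0 < k) (hkn : k < n)
    (hi : i < smallCount q k (n - k) (k * (n - k) + 1)) :
    (algorithmC q n k (Nat.digits q i)).cost ≤
      1533 * ((k * (n - k)) ^ 2 * (Nat.sqrt (k * (n - k)) + 1)) := by
  have hlen : (Nat.digits q i).length ≤ k * (n - k) + k + (n - k) := by
    rw [Nat.digits_length_le_iff (by omega)]
    rw [smallCount_eq_eval] at hi
    exact hi.trans_le (eval_boxPoly_le hq k (n - k))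
  set N := k * (n - k) with hN
  set s := Nat.sqrt N + 1 with hs
  have hsN : N + 1 ≤ s * s := Nat.lt_succ_sqrt N
  have hη : 0 < n - k := by omega
  have hkN : k ≤ N := Nat.le_mul_of_pos_right k hη
  have hηN : n - k ≤ N := Nat.le_mul_of_pos_left _ hk
  have hs1 : 1 ≤ s := by omega
  have hs2 : s ≤ 2 * N := by have := Nat.sqrt_le_self N; omega
  have hidx : ∀ a, a ≤ N + 1 → idxLen q a ≤ 2 * s := fun a ha => length_digits_le hq (by
    have h : s < 2 ^ s := Nat.lt_two_pow_self
    rw [two_mul, pow_add]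
    exact (ha.trans hsN).trans_lt (Nat.mul_lt_mul'' h h))
  have hcost := (algorithmC_spec (L := 2 * s) (W := 8 * s + 5) hq
    (fun a ha => hidx a (by omega))
    (fun a b c hc => length_digits_boxCount_le hq hs1 a b c (by omega)) hi).2
  refine hcost.trans ?_
  rw [← hN]
  have i1 := idxLen_le_self hq n
  have i2 := idxLen_le_self hq k
  have i3 := idxLen_le_self hq (n - k)
  generalize hηdef : n - k = η at *
  generalize hlendef : (Nat.digits q i).length = ℓ at *
  have hinit : idxLen q n + idxLen q k + 1 + 2 * (idxLen q k + 1) * (idxLen q η + 1) ≤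
      12 * N := by
    have h1 : (idxLen q k + 1) * (idxLen q η + 1) ≤ (2 * k) * (2 * η) :=
      Nat.mul_le_mul (by omega) (by omega)
    have h2 : (2 * k) * (2 * η) = 4 * N := by rw [hN]; ring
    rw [mul_assoc]
    omega
  have htable : (k + 1) * ((η + 1) * ((N + 1) * (24 * (2 * s) + 5 * (8 * s + 5) + 14) +
      4 * (2 * s) + 2) + 4 * (2 * s) + 2) ≤ 1076 * (N ^ 2 * s) := by
    have h1 : (N + 1) * (24 * (2 * s) + 5 * (8 * s + 5) + 14) ≤ (2 * N) * (127 * s) :=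
      Nat.mul_le_mul (by omega) (by omega)
    have h2 : s ≤ N * s := Nat.le_mul_of_pos_left _ (by omega)
    have h3 : (2 * N) * (127 * s) = 254 * (N * s) := by ring
    have h4 : (η + 1) * ((N + 1) * (24 * (2 * s) + 5 * (8 * s + 5) + 14) +
        4 * (2 * s) + 2) ≤ (2 * η) * (264 * (N * s)) :=
      Nat.mul_le_mul (by omega) (by omega)
    have h5 : N * s ≤ η * (N * s) := Nat.le_mul_of_pos_left _ hη
    have h6 : (2 * η) * (264 * (N * s)) = 528 * (η * (N * s)) := by ring
    refine (Nat.mul_le_mul (show k + 1 ≤ 2 * k by omega) (show _ ≤ 538 * (η * (N * s)) by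
      omega)).trans (le_of_eq ?_)
    rw [hN]; ring
  have hsearch : (N + 1) * (8 * (N + k + η + 1) + 3 * (8 * s + 5) + 2 * ℓ) ≤ 232 * N ^ 2 :=
    (Nat.mul_le_mul (show N + 1 ≤ 2 * N by omega) (show _ ≤ 116 * N by omega)).trans
      (le_of_eq (by ring))
  have hdiag : η * ((k + 1) * (8 * (N + k + η + 1) + 2 * (8 * s + 5) + 2 * ℓ) +
      7 * (N + k + η + 1)) ≤ 208 * N ^ 2 := by
    have h1 : (k + 1) * (8 * (N + k + η + 1) + 2 * (8 * s + 5) + 2 * ℓ) ≤ (2 * k) * (90 * N) :=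
      Nat.mul_le_mul (by omega) (by omega)
    have h2 : N ≤ k * N := Nat.le_mul_of_pos_left _ hk
    have h3 : (2 * k) * (90 * N) = 180 * (k * N) := by ring
    refine (Nat.mul_le_mul_left η (show _ ≤ 208 * (k * N) by omega)).trans (le_of_eq ?_)
    rw [hN]; ring
  have hN2 : N ≤ N ^ 2 := Nat.le_self_pow (by norm_num) N
  have hN2s : N ^ 2 ≤ N ^ 2 * s := Nat.le_mul_of_pos_right _ hs1
  omega

end Counted

theorem sq_mul_sqrt_add_one_le (a b : ℕ) (ha : 0 < a) (hb : 0 < b) :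
    (((a * b) ^ 2 * (Nat.sqrt (a * b) + 1) : ℕ) : ℝ) ≤
      2 * ((a : ℝ) ^ (5 / 2 : ℝ) * (b : ℝ) ^ (5 / 2 : ℝ)) := by
  have hab : 0 < a * b := Nat.mul_pos ha hb
  have hab1 : (1 : ℝ) ≤ ((a * b : ℕ) : ℝ) := by exact_mod_cast hab
  rw [← Real.mul_rpow (Nat.cast_nonneg a) (Nat.cast_nonneg b), ← Nat.cast_mul,
    show (5 / 2 : ℝ) = (2 : ℕ) + 1 / 2 by norm_num, Real.rpow_add (by linarith),
    Real.rpow_natCast, ← Real.sqrt_eq_rpow, Nat.cast_mul, Nat.cast_pow, Nat.cast_add, Nat.cast_one]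
  have h1 : (Nat.sqrt (a * b) : ℝ) ≤ √((a * b : ℕ) : ℝ) := Real.nat_sqrt_le_real_sqrt
  have h2 : 1 ≤ √((a * b : ℕ) : ℝ) := Real.one_le_sqrt.2 hab1
  have := mul_le_mul_of_nonneg_left (show (Nat.sqrt (a * b) : ℝ) + 1 ≤ 2 * √((a * b : ℕ) : ℝ) by
    linarith) (by positivity : (0 : ℝ) ≤ ((a * b : ℕ) : ℝ) ^ 2)
  linarith

theorem mainTheorem8 :
    ∃ C : ℝ, ∀ (F : Type*) [Field F] [Fintype F] (e : F ≃ Fin (Fintype.card F))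
      (n k i : ℕ), k ≤ n → (i : ℚ) < gaussCoeff (Fintype.card F) n k →
      (∃ D x : List ℕ,
        (Counted.algorithmC (Fintype.card F) n k (Nat.digits (Fintype.card F) i)).val
          = some (D, x) ∧
        ∃ X : Grass F n k, (∀ Y : Grass F n k, HasTableauxForm e Y D x ↔ Y = X) ∧
          indF e X = i) ∧
      (0 < k → k < n →
        ((Counted.algorithmC (Fintype.card F) n k (Nat.digits (Fintype.card F) i)).cost : ℝ)
          ≤ C * (k : ℝ) ^ (5 / 2 : ℝ) * ((n - k : ℕ) : ℝ) ^ (5 / 2 : ℝ)) := by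
  -- Twice `1533`, since `⌊√N⌋ + 1 ≤ 2 √N` for `N ≥ 1`.
  refine ⟨3066, fun F _ _ e n k i hk hi => ?_⟩
  have hq : 2 ≤ Fintype.card F := Fintype.one_lt_card
  have lt_small : ∀ j : ℕ, (j : ℚ) < gaussCoeff (Fintype.card F) n k →
      j < smallCount (Fintype.card F) k (n - k) (k * (n - k) + 1) := by
    intro j hj
    rw [← eval_boxPoly_eq_gaussCoeff hq hk, ← smallCount_eq_eval] at hj
    exact_mod_cast hj
  constructor
  · obtain ⟨D, x, hval, hform, hrank⟩ := Counted.algorithmC_result hq (lt_small i hi)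
    obtain ⟨X, hX⟩ := hform.exists_hasTableauxForm e hk
    refine ⟨D, x, hval, X, fun Y => ⟨fun hY => hY.subspace_unique hX, ?_⟩, ?_⟩
    · rintro rfl
      exact hX
    · rw [indF_eq_formRank hq e hk hX, hrank]
      intro j hj
      rw [hrank] at hj
      -- Surjectivity onto the smaller ranks comes from the algorithm itself, applied to each `j <
      -- i`.
      obtain ⟨D', x', -, hform', hrank'⟩ := Counted.algorithmC_result hq
        (lt_small j ((Nat.cast_lt.2 hj).trans hi))
      exact ⟨D', x', hform', hrank'⟩
  · intro hk0 hkn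
    have hcost := Counted.algorithmC_cost_le hq hk0 hkn (lt_small i hi)
    have hreal := sq_mul_sqrt_add_one_le k (n - k) hk0 (by omega)
    refine (Nat.cast_le.2 hcost).trans ?_
    rw [Nat.cast_mul, mul_assoc]
    push_cast at hreal ⊢
    linarith
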